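/- **Setting.** Let $q=(q_1,\dots,q_n)$ be non-negative rational feature qualities, given over a common denominator. A feature set is given by a decision vector $s\in\{0,1\}^n$, $F_s=\{j: s_j=1\}$, with univariate quality $Q(s)=\sum_j q_j s_j$. Let $k\ge 1$ be the feature-set size, $\tau\in[0,1]$ the dissimilarity threshold, and $d(F,F')=1-\frac{2|F\cap F'|}{|F|+|F'|}$ the Dice dissimilarity. Call $F$ and $F'$ alternatives if $d(F,F')\ge\tau$. For fixed constants $k,\tau$ consider three maximization problems: 1. *Sequential search*: an instance consists of $q$ and a list $\mathbb F$ of already found feature sets of size $k$ with $k+|\mathbb F|\cdot\lceil\tau k\rceil\le n$; maximize $Q(s)$ over all $s$ with $|F_s|=k$ and $d(F_s,F')\ge\tau$ for all $F'\in\mathbb F$. 2. *Simultaneous search with sum-aggregation*: an instance consists of $q$ and a number $a\in\mathbb N_0$ of alternatives (given in unary) with $k+a\lceil\tau k\rceil\le n$; maximize $\sum_{i=0}^a Q(s^{(i)})$ over all tuples $(s^{(0)},\dots,s^{(a)})$ with $|F_{s^{(i)}}|=k$ for all $i$ and $d(F_{s^{(i_1)}},F_{s^{(i_2)}})\ge\tau$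 for all $i_1\ne i_2$. 3. *Simultaneous search with min-aggregation*: the same with objective $\min_{0\le i\le a}Q(s^{(i)})$. *Greedy Replacement Search* sorts the features by descending quality and returns $s^{(0)},\dots,s^{(a)}$, where $s^{(i)}$ selects the first $\lfloor(1-\tau)k\rfloor$ features in this order together with the $i$-th block ($i=0,1,\dots$) of $\lceil\tau k\rceil$ consecutive features among the remaining ones; it stops before $a$ if $k+i\lceil\tau k\rceil>n$. APX is the class of NPO problems (instances and feasible solutions recognizable in polynomial time, feasible solutions of polynomial size, objective computable in polynomial time) that have a polynomial-time algorithm returning, on every instance with a feasible solution, a feasible solution of value at least $r$ times the optimum, for some constant $r>0$. Polynomial time is measured in the bit length of the input, on a random access machine with logarithmic cost. **Proposition.** - For every fixed $k\ge1$ and $\tau\in[0,1]$, all three problems lie in APX. - Greedy Replacement Search runs in polynomial time, uniformly in all its inputs: $q$, $k$, $a$ (in unary), and $\tau$ (as a fraction in $[0,1]$), with $k\geq 1$ and $k+a\lceil\tau k\rceil\le n$. - Let $k\ge1$, $\tau\in[0,1]$ and $k+a\lceil\tau k\rceil\le n$. Greedy Replacement Search returns $a+1$ decision vectors, which form a feasible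 solution of both simultaneous-search problems; its value is at least $\frac{\lfloor(1-\tau)k\rfloor}{k}$ times the optimum, both for sum- and for min-aggregation. For fixed $k$ and $\tau$ it is thus a polynomial-time approximation algorithm with this factor. - Under the same conditions each $s^{(i)}$ is feasible for sequential search with $\mathbb F=\{F_{s^{(0)}},\dots,F_{s^{(i-1)}}\}$, and $Q(s^{(i)})\ge\frac{\lfloor(1-\tau)k\rfloor}{k}\,Q(s)$ for every $s$ that is feasible for sequential search with any list $\mathbb F$ of previously found sets (in particular the optimum for its own history and that of any exact sequential search). -/

import Mathlib

/-! ### A random access machine with logarithmic cost -/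

namespace RAM

/-- The memory: infinitely many arrays of natural numbers; `m b j` is cell `j` of array `b`.
(A program addresses only the finitely many arrays named in its text; cell indices are computed.) -/
abbrev Memory := ℕ → ℕ → ℕ

/-- Arithmetic expressions; `read b e` is the content of the cell of array `b` with index `e`. -/
inductive Expr where
  | lit (n : ℕ)
  | read (b : ℕ) (e : Expr)
  | add (e₁ e₂ : Expr)
  | sub (e₁ e₂ : Expr)
  | mul (e₁ e₂ : Expr)
  | div (e₁ e₂ : Expr)

/-- The value of an expression (truncated subtraction, integer division). -/
def Expr.eval (m : Memory) : Expr → ℕ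
  | .lit n => n
  | .read b e => m b (e.eval m)
  | .add e₁ e₂ => e₁.eval m + e₂.eval m
  | .sub e₁ e₂ => e₁.eval m - e₂.eval m
  | .mul e₁ e₂ => e₁.eval m * e₂.eval m
  | .div e₁ e₂ => e₁.eval m / e₂.eval m

/-- The cost of one elementary operation on the numbers `u` and `v`: one plus their bit lengths. -/
def opCost (u v : ℕ) : ℕ := 1 + Nat.size u + Nat.size v

/-- The logarithmic cost of evaluating an expression. -/
def Expr.cost (m : Memory) : Expr → ℕ
  | .lit n => 1 + Nat.size n
  | .read b e => e.cost m + opCost (e.eval m) (m b (e.eval m))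
  | .add e₁ e₂ => e₁.cost m + e₂.cost m + opCost (e₁.eval m) (e₂.eval m)
  | .sub e₁ e₂ => e₁.cost m + e₂.cost m + opCost (e₁.eval m) (e₂.eval m)
  | .mul e₁ e₂ => e₁.cost m + e₂.cost m + opCost (e₁.eval m) (e₂.eval m)
  | .div e₁ e₂ => e₁.cost m + e₂.cost m + opCost (e₁.eval m) (e₂.eval m)

/-- Programs: assignment to a cell, sequencing, branching and looping on `e₁ ≤ e₂`. -/
inductive Prog where
  | write (b : ℕ) (idx val : Expr)
  | seq (p₁ p₂ : Prog)
  | ifLE (e₁ e₂ : Expr) (p₁ p₂ : Prog)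
  | whileLE (e₁ e₂ : Expr) (p : Prog)

/-- The cost of testing `e₁ ≤ e₂`. -/
def testCost (m : Memory) (e₁ e₂ : Expr) : ℕ :=
  e₁.cost m + e₂.cost m + opCost (e₁.eval m) (e₂.eval m)

/-- `Exec p m t m'`: the program `p`, started in memory `m`, halts in memory `m'` at total
cost `t`. -/
inductive Exec : Prog → Memory → ℕ → Memory → Prop where
  | write (b : ℕ) (idx val : Expr) (m : Memory) :
      Exec (.write b idx val) m
        (idx.cost m + val.cost m + opCost (idx.eval m) (val.eval m))
        (Function.update m b (Function.update (m b) (idx.eval m) (val.eval m)))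
  | seq {p₁ p₂ : Prog} {m₁ m₂ m₃ : Memory} {t₁ t₂ : ℕ} :
      Exec p₁ m₁ t₁ m₂ → Exec p₂ m₂ t₂ m₃ → Exec (.seq p₁ p₂) m₁ (t₁ + t₂) m₃
  | ifTrue {e₁ e₂ : Expr} {p₁ p₂ : Prog} {m m' : Memory} {t : ℕ} :
      e₁.eval m ≤ e₂.eval m → Exec p₁ m t m' →
      Exec (.ifLE e₁ e₂ p₁ p₂) m (testCost m e₁ e₂ + t) m'
  | ifFalse {e₁ e₂ : Expr} {p₁ p₂ : Prog} {m m' : Memory} {t : ℕ} :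
      ¬ e₁.eval m ≤ e₂.eval m → Exec p₂ m t m' →
      Exec (.ifLE e₁ e₂ p₁ p₂) m (testCost m e₁ e₂ + t) m'
  | whileTrue {e₁ e₂ : Expr} {p : Prog} {m₁ m₂ m₃ : Memory} {t₁ t₂ : ℕ} :
      e₁.eval m₁ ≤ e₂.eval m₁ → Exec p m₁ t₁ m₂ → Exec (.whileLE e₁ e₂ p) m₂ t₂ m₃ →
      Exec (.whileLE e₁ e₂ p) m₁ (testCost m₁ e₁ e₂ + t₁ + t₂) m₃
  | whileFalse {e₁ e₂ : Expr} {p : Prog} {m : Memory} :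
      ¬ e₁.eval m ≤ e₂.eval m → Exec (.whileLE e₁ e₂ p) m (testCost m e₁ e₂) m

/-- The initial memory for the input word `w`: array `0` holds the length of `w` in cell `0` and
the letters of `w` in the cells `1, 2, …`; every other cell is `0`. -/
def initMemory (w : List ℕ) : Memory :=
  fun b j => if b = 0 then (w.length :: w).getD j 0 else 0

/-- The output word, stored in array `1` in the same format. -/
def output (m : Memory) : List ℕ := (List.range (m 1 0)).map fun i => m 1 (i + 1)

/-- The size of a word of natural numbers written in binary. -/
def wordSize (w : List ℕ) : ℕ := (w.map fun x => Nat.size x + 1).sum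

/-- Some program, on the encoding of every `x` in the domain `D`, halts with an output `w`
satisfying `R x w`, in time (plus output size) polynomial in the size of the encoding. -/
def PolyTime {α : Type} (enc : α → List ℕ) (D : α → Prop) (R : α → List ℕ → Prop) : Prop :=
  ∃ (p : Prog) (T : Polynomial ℕ), ∀ x, D x → ∃ t m,
    Exec p (initMemory (enc x)) t m ∧
    t + wordSize (output m) ≤ T.eval (wordSize (enc x)) ∧
    R x (output m)

/-- The answer of a decision procedure for the proposition `A`. -/
def Answer (A : Prop) (w : List ℕ) : Prop := (A ∧ w = [1]) ∨ (¬ A ∧ w = [0])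

/-- Encoding of a pair of words. -/
def pairWord (u v : List ℕ) : List ℕ := u.length :: (u ++ v)

end RAM

/-! ### Maximization problems, `NPO` and `APX` -/

/-- A maximization problem. `Inst` and `Sol x` are the types of candidate instances and candidate
solutions with their (injective) encodings, `IsInst` singles out the admissible instances,
`Feasible x` the feasible solutions of `x`, and `value` is the objective. -/
structure MaxProblem where
  Inst : Type
  Sol : Inst → Type
  encInst : Inst → List ℕ
  encSol : ∀ x, Sol x → List ℕ
  encInst_injective : Function.Injective encInst
  encSol_injective : ∀ x, Function.Injective (encSol x)
  IsInst : Inst → Prop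
  Feasible : ∀ x, Sol x → Prop
  value : ∀ x, Sol x → ℚ

namespace MaxProblem

open RAM

/-- Membership in `NPO`: instances are recognizable in polynomial time, feasible solutions have
polynomial size and are recognizable in polynomial time, and the objective value of a feasible
solution is computable (as a fraction) in polynomial time. -/
structure InNPO (P : MaxProblem) : Prop where
  recognize : PolyTime (fun w : List ℕ => w) (fun _ => True)
    (fun w => Answer (∃ x, P.IsInst x ∧ P.encInst x = w))
  bounded : ∃ B : Polynomial ℕ, ∀ x, P.IsInst x → ∀ y, P.Feasible x y →
    wordSize (P.encSol x y) ≤ B.eval (wordSize (P.encInst x))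
  verify : PolyTime (fun z : P.Inst × List ℕ => pairWord (P.encInst z.1) z.2)
    (fun z => P.IsInst z.1)
    (fun z => Answer (∃ y, P.Feasible z.1 y ∧ P.encSol z.1 y = z.2))
  evaluate : PolyTime (fun z : (x : P.Inst) × P.Sol x => pairWord (P.encInst z.1) (P.encSol z.1 z.2))
    (fun z => P.IsInst z.1 ∧ P.Feasible z.1 z.2)
    (fun z w => ∃ u v : ℕ, w = [u, v] ∧ 0 < v ∧ P.value z.1 z.2 = (u : ℚ) / v)

/-- `f` is a polynomial-time algorithm that, on every instance with a feasible solution, returns a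
feasible solution whose value is at least `r` times the value of any feasible solution. -/
def IsApproxAlgorithm (P : MaxProblem) (f : ∀ x, P.Sol x) (r : ℚ) : Prop :=
  PolyTime P.encInst P.IsInst (fun x w => w = P.encSol x (f x)) ∧
  ∀ x, P.IsInst x → (∃ y, P.Feasible x y) →
    P.Feasible x (f x) ∧ ∀ y, P.Feasible x y → r * P.value x y ≤ P.value x (f x)

/-- Membership in `APX`: an `NPO` problem with a polynomial-time approximation algorithm of some
constant factor `r > 0`. -/
def InAPX (P : MaxProblem) : Prop :=
  P.InNPO ∧ ∃ (f : ∀ x, P.Sol x) (r : ℚ), 0 < r ∧ P.IsApproxAlgorithm f r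

end MaxProblem

/-! ### Alternative feature selection -/

namespace AFS

/-- A feature-selection decision vector `s ∈ {0,1}ⁿ`. -/
abbrev Selection (n : ℕ) := Fin n → Bool

/-- The feature set `F_s` selected by `s`. -/
def featureSet {n : ℕ} (s : Selection n) : Finset (Fin n) := Finset.univ.filter fun j => s j = true

/-- The Dice dissimilarity of two feature sets. -/
noncomputable def dice {n : ℕ} (F F' : Finset (Fin n)) : ℝ :=
  1 - 2 * ((F ∩ F').card : ℝ) / ((F.card : ℝ) + (F'.card : ℝ))

/-- `F` is an alternative to `F'` for the dissimilarity threshold `τ`. -/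
def IsAlternative {n : ℕ} (τ : ℝ) (F F' : Finset (Fin n)) : Prop := τ ≤ dice F F'

/-- The univariate quality `∑ⱼ qⱼ sⱼ` of a selection. -/
def univariateQuality {n : ℕ} (q : Fin n → ℚ) (s : Selection n) : ℚ :=
  ∑ j, q j * (if s j then 1 else 0)

/-- `n` non-negative rational feature qualities, given over a common denominator. -/
structure Qualities where
  n : ℕ
  den : ℕ
  num : Fin n → ℕ

/-- The quality of feature `j`. -/
def Qualities.q (D : Qualities) (j : Fin D.n) : ℚ := (D.num j : ℚ) / (D.den : ℚ)

/-- The word of a decision vector. -/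
def bits {n : ℕ} (s : Selection n) : List ℕ := List.ofFn fun j => (s j).toNat

theorem bits_length {n : ℕ} (s : Selection n) : (bits s).length = n := by simp [bits]

theorem bits_injective {n : ℕ} : Function.Injective (bits (n := n)) := by
  intro s s' h
  have h' := List.ofFn_injective h
  funext j
  have hj := congrFun h' j
  revert hj
  cases s j <;> cases s' j <;> simp

theorem flatMap_bits_injective {n : ℕ} :
    ∀ {l l' : List (Selection n)}, l.length = l'.length → l.flatMap bits = l'.flatMap bits →
      l = l'
  | [], [], _, _ => rfl
  | [], _ :: _, h, _ => by simp at h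
  | _ :: _, [], h, _ => by simp at h
  | s :: l, s' :: l', h, e => by
    simp only [List.flatMap_cons] at e
    obtain ⟨e₁, e₂⟩ := List.append_inj e (by simp [bits_length])
    rw [bits_injective e₁, flatMap_bits_injective (by simpa using h) e₂]

/-! #### Sequential search -/

/-- An iteration of sequential search: qualities and the list of feature sets found so far. -/
structure SeqInst extends Qualities where
  found : List (Selection n)

/-- Encoding of an iteration of sequential search. -/
def encSeq (x : SeqInst) : List ℕ :=
  x.den :: x.n :: x.found.length :: (List.ofFn x.num ++ x.found.flatMap bits)

theorem encSeq_injective : Function.Injective encSeq := by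
  rintro ⟨⟨n, d, q⟩, l⟩ ⟨⟨n', d', q'⟩, l'⟩ h
  simp only [encSeq, List.cons.injEq] at h
  obtain ⟨rfl, rfl, hl, h⟩ := h
  obtain ⟨h₁, h₂⟩ := List.append_inj h (by simp)
  obtain rfl := List.ofFn_injective h₁
  obtain rfl := flatMap_bits_injective hl h₂
  rfl

/-- The sequential-search problem for feature-set size `k` and dissimilarity threshold `τ`: find
one feature set of size `k` of maximum quality that is an alternative to each feature set found so
far. The number of those takes the place of `a` in the condition `k + a ⌈τ k⌉ ≤ n`. -/
noncomputable def sequentialProblem (k : ℕ) (τ : ℝ) : MaxProblem where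
  Inst := SeqInst
  Sol x := Selection x.n
  encInst := encSeq
  encSol _ := bits
  encInst_injective := encSeq_injective
  encSol_injective _ := bits_injective
  IsInst x := 0 < x.den ∧ (∀ s ∈ x.found, (featureSet s).card = k) ∧
    k + x.found.length * ⌈τ * k⌉₊ ≤ x.n
  Feasible x s := (featureSet s).card = k ∧
    ∀ s' ∈ x.found, IsAlternative τ (featureSet s) (featureSet s')
  value x s := univariateQuality x.q s

/-! #### Simultaneous search -/

/-- An instance of simultaneous search: qualities and the number `a` of alternatives. -/
structure SimInst extends Qualities where
  a : ℕ

/-- Encoding of an instance of simultaneous search. The number `a` is also padded in unary, since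
a solution consists of `a + 1` decision vectors. -/
def encSim (x : SimInst) : List ℕ :=
  x.den :: x.n :: x.a :: (List.ofFn x.num ++ List.replicate x.a 0)

theorem encSim_injective : Function.Injective encSim := by
  rintro ⟨⟨n, d, q⟩, a⟩ ⟨⟨n', d', q'⟩, a'⟩ h
  simp only [encSim, List.cons.injEq] at h
  obtain ⟨rfl, rfl, rfl, h⟩ := h
  obtain ⟨h₁, -⟩ := List.append_inj h (by simp)
  obtain rfl := List.ofFn_injective h₁
  rfl

/-- Encoding of a tuple of decision vectors. -/
def encTuple {n a : ℕ} (s : Fin (a + 1) → Selection n) : List ℕ := (List.ofFn s).flatMap bits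

theorem encTuple_injective {n a : ℕ} : Function.Injective (encTuple (n := n) (a := a)) :=
  fun _ _ h => List.ofFn_injective (flatMap_bits_injective (by simp) h)

/-- The simultaneous-search problem for feature-set size `k`, dissimilarity threshold `τ` and
aggregation operator `agg`: find `a + 1` feature sets of size `k`, pairwise alternatives, of maximum
aggregated quality. -/
noncomputable def simultaneousProblem (agg : ∀ a : ℕ, (Fin (a + 1) → ℚ) → ℚ) (k : ℕ) (τ : ℝ) :
    MaxProblem where
  Inst := SimInst
  Sol x := Fin (x.a + 1) → Selection x.n
  encInst := encSim
  encSol _ := encTuple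
  encInst_injective := encSim_injective
  encSol_injective _ := encTuple_injective
  IsInst x := 0 < x.den ∧ k + x.a * ⌈τ * k⌉₊ ≤ x.n
  Feasible _ s := (∀ i, (featureSet (s i)).card = k) ∧
    ∀ i₁ i₂, i₁ ≠ i₂ → IsAlternative τ (featureSet (s i₁)) (featureSet (s i₂))
  value x s := agg x.a fun i => univariateQuality x.q (s i)

/-- Sum-aggregation. -/
def sumAgg (a : ℕ) (v : Fin (a + 1) → ℚ) : ℚ := ∑ i, v i

/-- Min-aggregation. -/
def minAgg (a : ℕ) (v : Fin (a + 1) → ℚ) : ℚ := Finset.univ.inf' Finset.univ_nonempty v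

/-! #### Greedy Replacement Search -/

/-- The features in order of descending quality (ties in order of their index). -/
def sortIndices {n : ℕ} (q : Fin n → ℚ) : List (Fin n) :=
  (List.finRange n).insertionSort fun i j => q j ≤ q i

/-- The `i`-th decision vector of Greedy Replacement Search: it selects the `⌊(1 - τ) k⌋` best
features and, of the remaining features in descending order, the `i`-th block of `⌈τ k⌉` ones. -/
noncomputable def greedySelection {n : ℕ} (q : Fin n → ℚ) (k : ℕ) (τ : ℝ) (i : ℕ) : Selection n :=
  fun j =>
    decide (j ∈ (sortIndices q).take ⌊(1 - τ) * k⌋₊) ||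
    decide (j ∈ ((sortIndices q).drop (⌊(1 - τ) * k⌋₊ + i * ⌈τ * k⌉₊)).take ⌈τ * k⌉₊)

/-- Greedy Replacement Search: the decision vectors for `i = 0, …, a`, as long as there are enough
unused features, i.e. as long as `k + i ⌈τ k⌉ ≤ n`. -/
noncomputable def greedyReplacement {n : ℕ} (q : Fin n → ℚ) (k a : ℕ) (τ : ℝ) :
    List (Selection n) :=
  ((List.range (a + 1)).filter fun i => decide (k + i * ⌈τ * k⌉₊ ≤ n)).map (greedySelection q k τ)

/-- The output of Greedy Replacement Search as a tuple of `a + 1` decision vectors. -/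
noncomputable def greedyTuple (k : ℕ) (τ : ℝ) (x : SimInst) : Fin (x.a + 1) → Selection x.n :=
  fun i => (greedyReplacement x.q k x.a τ).getD i (fun _ => false)

/-- The iteration of sequential search that follows the first `i` results of Greedy Replacement
Search. -/
noncomputable def greedyIteration (k : ℕ) (τ : ℝ) (x : SimInst) (i : ℕ) : SeqInst where
  toQualities := x.toQualities
  found := (greedyReplacement x.q k x.a τ).take i

/-- Complete input of Greedy Replacement Search: qualities, `a`, the feature-set size `k` and the
threshold `τ` as a fraction. -/
structure GreedyInput extends SimInst where
  k : ℕ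
  tauNum : ℕ
  tauDen : ℕ

/-- The dissimilarity threshold of an input. -/
noncomputable def GreedyInput.τ (x : GreedyInput) : ℝ := (x.tauNum : ℝ) / (x.tauDen : ℝ)

/-- Encoding of the complete input. -/
def encGreedyInput (x : GreedyInput) : List ℕ :=
  x.k :: x.tauNum :: x.tauDen :: encSim x.toSimInst

/-- Admissible inputs: `k ≥ 1`, `τ ∈ [0,1]`, positive denominators and `k + a ⌈τ k⌉ ≤ n`. -/
def GreedyInput.IsValid (x : GreedyInput) : Prop :=
  0 < x.k ∧ 0 < x.tauDen ∧ x.tauNum ≤ x.tauDen ∧ 0 < x.den ∧ x.k + x.a * ⌈x.τ * x.k⌉₊ ≤ x.n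

/-- The guaranteed fraction `⌊(1 - τ) k⌋ / k`. -/
noncomputable def ratio (k : ℕ) (τ : ℝ) : ℚ := (⌊(1 - τ) * k⌋₊ : ℚ) / (k : ℚ)

end AFS

/-! The guarantee rests on one averaging fact: the best `p` features carry at least `p / k` of the
quality of any `k ≥ p` features, because the `p`-th best feature separates them from all the others
(`mul_sum_le_mul_sum_rank_lt`). Every greedy selection contains the best `p = ⌊(1 - τ) k⌋` features
and qualities are non-negative, so each one has at least `p / k` times the quality of any set of
size `k`, whatever its dissimilarity to other sets (`ratio_mul_le_greedySelection`). A bound for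
each single set passes to sums and to minima. For sets of size `k`, being alternatives means sharing
at most `p` features (`isAlternative_iff`); greedy selections have size `p + ⌈τ k⌉ = k` and share
only their prefix.

For `p > 0` this puts simultaneous search into APX. For `p = 0` the factor vanishes, but then
alternatives are disjoint and `n ≥ (a + 1) k`. Dealing out the best `(a + 1) k` features cyclically
is optimal for the sum (`sum_le_sum_strideTuple`) and loses at most a factor `k` for the minimum
(`exists_le_mul_strideTuple`). Sequential search is solved exactly: since `k` is fixed, every set of
size `k` has a code of `k` digits, and there are polynomially many codes.

For the running times no individual programs are analysed. Arithmetic terms with sums over `i < (l +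
1) ^ κ` are compiled once and for all, with values and costs bounded by a power of the input size
(`Term.code_spec`), and an output word whose length and letters are terms is computable in
polynomial time (`polyTime_of_terms`). Sorting becomes counting: the position of a feature in the
sorted list is the number of features that precede it (`idxOf_sortIndices`). Minimization and search
become sums with a single nonzero summand, the first optimal index (`exists_first_min`,
`Term.eval_sum_unique`). -/

namespace RAM

/-! ### Terms with bounded sums run in polynomial time -/

/-- The arithmetic operations of the machine. -/
inductive Op where
  | add | sub | mul | div

/-- The function computed by an operation. -/
def Op.fn : Op → ℕ → ℕ → ℕ
  | .add, a, b => a + b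
  | .sub, a, b => a - b
  | .mul, a, b => a * b
  | .div, a, b => a / b

/-- The machine expression of an operation. -/
def Op.expr : Op → Expr → Expr → Expr
  | .add => .add
  | .sub => .sub
  | .mul => .mul
  | .div => .div

/-- Arithmetic terms over the input word, with variables named by numbers, and with sums over
`i < (l + 1) ^ κ`, where `l` is the length of the input word. -/
inductive Term where
  | lit (n : ℕ)
  | var (i : ℕ)
  | inp (e : Term)
  | bin (o : Op) (a b : Term)
  | sum (v κ : ℕ) (body : Term)

/-- The content of a cell of the input array. -/
def cell (w : List ℕ) (j : ℕ) : ℕ := (w.length :: w).getD j 0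

/-- The value of a term for the input word `w` and the values `ρ` of the variables. -/
def Term.eval (w : List ℕ) : Term → (ℕ → ℕ) → ℕ
  | .lit n, _ => n
  | .var i, ρ => ρ i
  | .inp e, ρ => cell w (e.eval w ρ)
  | .bin o a b, ρ => o.fn (a.eval w ρ) (b.eval w ρ)
  | .sum v κ body, ρ =>
    ∑ i ∈ Finset.range ((w.length + 1) ^ κ), body.eval w (Function.update ρ v i)

/-- The expression for `(l + 1) ^ κ`, where `l` is the length of the input word. -/
def lenPow : ℕ → Expr
  | 0 => .lit 1
  | κ + 1 => .mul (lenPow κ) (.add (.read 0 (.lit 0)) (.lit 1))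

/-- A program that stores the value of a term in cell `h` of array `3` and leaves the smaller cells
of this array and all other arrays unchanged. The variables are stored in array `2`. -/
def Term.code : Term → ℕ → Prog
  | .lit n, h => .write 3 (.lit h) (.lit n)
  | .var i, h => .write 3 (.lit h) (.read 2 (.lit i))
  | .inp e, h => .seq (e.code h) (.write 3 (.lit h) (.read 0 (.read 3 (.lit h))))
  | .bin o a b, h => .seq (a.code h) (.seq (b.code (h + 1))
      (.write 3 (.lit h) (o.expr (.read 3 (.lit h)) (.read 3 (.lit (h + 1))))))
  | .sum v κ body, h =>
    .seq (.write 3 (.lit h) (.lit 0)) <|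
    .seq (.write 3 (.lit (h + 1)) (.read 2 (.lit v))) <|
    .seq (.write 2 (.lit v) (.lit 0)) <|
    -- The machine only tests `≤`, so the strict bound on the loop variable is tested on its
    -- successor.
    .seq (.whileLE (.add (.read 2 (.lit v)) (.lit 1)) (lenPow κ)
      (.seq (body.code (h + 2))
        (.seq (.write 3 (.lit h) (.add (.read 3 (.lit h)) (.read 3 (.lit (h + 2)))))
          (.write 2 (.lit v) (.add (.read 2 (.lit v)) (.lit 1))))))
    (.write 2 (.lit v) (.read 3 (.lit (h + 1))))

/-- `X` bounds the length of the word `w` and the bit lengths of its letters. -/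
structure Fits (w : List ℕ) (X : ℕ) : Prop where
  two_le : 2 ≤ X
  length_lt : w.length + 1 ≤ X
  size_cell : ∀ j, Nat.size (cell w j) ≤ X

/-- Inside a sum the summation variable reaches `(l + 1) ^ κ`; the body is therefore analysed with
the larger bound `X ^ (κ + 1)`. -/
theorem Fits.pow {w : List ℕ} {X : ℕ} (h : Fits w X) (κ : ℕ) : Fits w (X ^ (κ + 1)) := by
  have hX : X ≤ X ^ (κ + 1) := Nat.le_self_pow (by omega) X
  exact ⟨h.two_le.trans hX, h.length_lt.trans hX, fun j => (h.size_cell j).trans hX⟩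

/-! ### Bit lengths and powers -/

theorem size_le_self (n : ℕ) : Nat.size n ≤ n := Nat.size_le.2 n.lt_two_pow_self

theorem size_add_le (a b : ℕ) : Nat.size (a + b) ≤ Nat.size a + Nat.size b + 1 := by
  rw [Nat.size_le]
  have ha := Nat.lt_size_self a
  have hb := Nat.lt_size_self b
  have h1 : 2 ^ Nat.size a ≤ 2 ^ (Nat.size a + Nat.size b) := Nat.pow_le_pow_right (by norm_num) (by omega)
  have h2 : 2 ^ Nat.size b ≤ 2 ^ (Nat.size a + Nat.size b) := Nat.pow_le_pow_right (by norm_num) (by omega)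
  rw [pow_succ]; omega

theorem size_mul_le (a b : ℕ) : Nat.size (a * b) ≤ Nat.size a + Nat.size b := by
  rw [Nat.size_le, pow_add]
  exact Nat.mul_lt_mul'' (Nat.lt_size_self a) (Nat.lt_size_self b)

theorem Op.size_fn_le (o : Op) (a b : ℕ) : Nat.size (o.fn a b) ≤ Nat.size a + Nat.size b + 1 := by
  cases o
  · exact size_add_le a b
  · exact (Nat.size_le_size (Nat.sub_le a b)).trans (by omega)
  · exact (size_mul_le a b).trans (by omega)
  · exact (Nat.size_le_size (Nat.div_le_self a b)).trans (by omega)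

theorem Op.eval_expr (o : Op) (m : Memory) (a b : Expr) :
    (o.expr a b).eval m = o.fn (a.eval m) (b.eval m) := by cases o <;> rfl

theorem Op.cost_expr (o : Op) (m : Memory) (a b : Expr) :
    (o.expr a b).cost m = a.cost m + b.cost m + opCost (a.eval m) (b.eval m) := by cases o <;> rfl

theorem le_pow_self {X : ℕ} (hX : 2 ≤ X) (K : ℕ) : K ≤ X ^ K :=
  (K.lt_two_pow_self.le).trans (Nat.pow_le_pow_left hX K)

/-- Constant factors are absorbed into the exponent, so that every cost bound can be kept in the
form `X ^ d`. -/
theorem mul_pow_le {X : ℕ} (hX : 2 ≤ X) (K d : ℕ) : K * X ^ d ≤ X ^ (K + d) := by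
  rw [pow_add]; exact Nat.mul_le_mul_right _ (le_pow_self hX K)

/-- The sum is at most `M * 2 ^ Z`. Adding `M` rather than its bit length is wasteful but harmless,
as the number of summands is polynomial. -/
theorem size_sum_le (M Z : ℕ) (f : ℕ → ℕ) (h : ∀ i < M, Nat.size (f i) ≤ Z) :
    Nat.size (∑ i ∈ Finset.range M, f i) ≤ M + Z := by
  rcases Nat.eq_zero_or_pos M with rfl | hM
  · simp
  rw [Nat.size_le, pow_add]
  calc ∑ i ∈ Finset.range M, f i ≤ ∑ i ∈ Finset.range M, 2 ^ Z :=
        Finset.sum_le_sum fun i hi => (Nat.size_le.1 (h i (Finset.mem_range.1 hi))).le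
    _ = M * 2 ^ Z := by simp
    _ < 2 ^ M * 2 ^ Z := Nat.mul_lt_mul_of_pos_right M.lt_two_pow_self (by positivity)

theorem lenPow_eval (κ : ℕ) {w : List ℕ} {m : Memory} (hm : m 0 = cell w) :
    (lenPow κ).eval m = (w.length + 1) ^ κ := by
  induction κ with
  | zero => rfl
  | succ κ ih => simp [lenPow, Expr.eval, ih, hm, cell, pow_succ]

theorem lenPow_cost (κ : ℕ) : ∃ d, ∀ (w : List ℕ) (X : ℕ), Fits w X → ∀ m : Memory,
    m 0 = cell w → (lenPow κ).cost m ≤ X ^ d := by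
  induction κ with
  | zero => exact ⟨2, fun w X h m _ => (show 1 + Nat.size 1 ≤ 2 by simp).trans (le_pow_self h.two_le 2)⟩
  | succ κ ih =>
    obtain ⟨d, ih⟩ := ih
    refine ⟨20 + (d + κ + 1), fun w X h m hm => ?_⟩
    have hX := h.two_le
    have hX0 : 0 < X := by omega
    have h1 := ih w X h m hm
    have h2 : X ^ d ≤ X ^ (d + κ + 1) := Nat.pow_le_pow_right hX0 (by omega)
    have h3 : X ^ κ ≤ X ^ (d + κ + 1) := Nat.pow_le_pow_right hX0 (by omega)
    have h4 : X ^ 1 ≤ X ^ (d + κ + 1) := Nat.pow_le_pow_right hX0 (by omega)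
    have h5 := mul_pow_le hX 20 (d + κ + 1)
    have h6 : Nat.size ((w.length + 1) ^ κ) ≤ X ^ κ :=
      (size_le_self _).trans (Nat.pow_le_pow_left h.length_lt κ)
    have h7 : Nat.size (w.length + 1) ≤ X := (size_le_self _).trans h.length_lt
    have h8 : Nat.size w.length ≤ X := (size_le_self _).trans (by have := h.length_lt; omega)
    simp only [lenPow, Expr.cost, Expr.eval, lenPow_eval κ hm, opCost, hm, cell, Nat.size_one,
      Nat.size_zero, List.getD_cons_zero]
    rw [pow_one] at h4
    omega

/-- A counting loop. -/
theorem exec_count {e₁ e₂ : Expr} {p : Prog} {M C : ℕ} {Inv : ℕ → Memory → Prop}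
    (htest : ∀ i m, i ≤ M → Inv i m → e₁.eval m = i + 1 ∧ e₂.eval m = M ∧ testCost m e₁ e₂ ≤ C)
    (hbody : ∀ i m, i < M → Inv i m → ∃ t m', Exec p m t m' ∧ t ≤ C ∧ Inv (i + 1) m') :
    ∀ j i m, i + j = M → Inv i m →
      ∃ t m', Exec (.whileLE e₁ e₂ p) m t m' ∧ t ≤ j * (2 * C) + C ∧ Inv M m'
  -- Each round pays `2 * C` for its test and its body; the remaining `C` pays for the final failing
  -- test.
  | 0, i, m, hij, hm => by
    obtain ⟨h1, h2, h3⟩ := htest i m (by omega) hm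
    exact ⟨_, m, Exec.whileFalse (by omega), by omega, by rwa [← hij]⟩
  | j + 1, i, m, hij, hm => by
    obtain ⟨h1, h2, h3⟩ := htest i m (by omega) hm
    obtain ⟨t, m', h4, h5, h6⟩ := hbody i m (by omega) hm
    obtain ⟨t', m'', h7, h8, h9⟩ := exec_count htest hbody j (i + 1) m' (by omega) h6
    exact ⟨_, m'', Exec.whileTrue (by omega) h4 h7, by rw [Nat.succ_mul]; omega, h9⟩

/-- Structural induction, with array `3` used as a stack: intermediate results live at and above
cell `h`. A sum saves the old value of its variable on the stack and restores it afterwards, which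
is why array `2` ends unchanged. The exponent `d` depends only on the term and on `h`, while `X`
stays arbitrary, because the body of a sum is treated with a larger `X`. -/
theorem Term.code_spec (e : Term) : ∀ h : ℕ, ∃ d, ∀ (w : List ℕ) (X : ℕ), Fits w X →
    ∀ m : Memory, m 0 = cell w → (∀ i, Nat.size (m 2 i) ≤ X) →
      Nat.size (e.eval w (m 2)) ≤ X ^ d ∧
      ∃ t m', Exec (e.code h) m t m' ∧ t ≤ X ^ d ∧ m' 3 h = e.eval w (m 2) ∧
        (∀ b, b ≠ 3 → m' b = m b) ∧ ∀ j < h, m' 3 j = m 3 j := by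
  induction e with
  | lit n =>
    intro h
    refine ⟨10 + (Nat.size n + Nat.size h), fun w X hX m h0 h2 => ?_⟩
    have h5 := le_pow_self hX.two_le (Nat.size n + Nat.size h)
    have h6 := mul_pow_le hX.two_le 10 (Nat.size n + Nat.size h)
    have h7 : 0 < X ^ (Nat.size n + Nat.size h) := pow_pos (by have := hX.two_le; omega) _
    refine ⟨by simp only [Term.eval]; omega, _, _, Exec.write _ _ _ _, ?_, ?_, ?_, ?_⟩
    · simp only [Expr.cost, Expr.eval, opCost]; omega
    · simp [Expr.eval, Term.eval]
    · intro b hb; simp [hb]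
    · intro j hj; simp [Expr.eval, hj.ne]
  | var i =>
    intro h
    refine ⟨10 + (Nat.size i + Nat.size h + 1), fun w X hX m h0 h2 => ?_⟩
    have h5 := le_pow_self hX.two_le (Nat.size i + Nat.size h + 1)
    have h6 := mul_pow_le hX.two_le 10 (Nat.size i + Nat.size h + 1)
    have h7 : X ≤ X ^ (Nat.size i + Nat.size h + 1) := Nat.le_self_pow (by omega) X
    have h8 := h2 i
    refine ⟨by simp only [Term.eval]; omega, _, _, Exec.write _ _ _ _, ?_, ?_, ?_, ?_⟩
    · simp only [Expr.cost, Expr.eval, opCost]; omega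
    · simp [Expr.eval, Term.eval]
    · intro b hb; simp [hb]
    · intro j hj; simp [Expr.eval, hj.ne]
  | inp e ih =>
    intro h
    obtain ⟨d, ih⟩ := ih h
    refine ⟨20 + (d + Nat.size h + 1), fun w X hX m h0 h2 => ?_⟩
    obtain ⟨hs, t, m', hex, ht, hr, hb, hj⟩ := ih w X hX m h0 h2
    have hX2 := hX.two_le
    have h4 := le_pow_self hX.two_le (d + Nat.size h + 1)
    have h5 : X ^ d ≤ X ^ (d + Nat.size h + 1) := Nat.pow_le_pow_right (by omega) (by omega)
    have h6 := mul_pow_le hX.two_le 20 (d + Nat.size h + 1)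
    have h7 : X ≤ X ^ (d + Nat.size h + 1) := Nat.le_self_pow (by omega) X
    have h8 := hX.size_cell (e.eval w (m 2))
    refine ⟨by simp only [Term.eval]; omega, _, _, hex.seq (Exec.write _ _ _ _), ?_, ?_, ?_, ?_⟩
    · simp only [Expr.cost, Expr.eval, opCost, hr, hb 0 (by decide), h0]; omega
    · simp [Expr.eval, Term.eval, hr, hb 0, h0]
    · intro b hb'; simp [hb', hb]
    · intro j hj'; simp [Expr.eval, hj'.ne, hj j hj']
  | bin o a b iha ihb =>
    intro h
    obtain ⟨d₁, iha⟩ := iha h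
    obtain ⟨d₂, ihb⟩ := ihb (h + 1)
    set D := d₁ + d₂ + Nat.size h + Nat.size (h + 1) + 1 with hD
    refine ⟨20 + D, fun w X hX m h0 h2 => ?_⟩
    obtain ⟨hs, t, m', hex, ht, hr, hb, hj⟩ := iha w X hX m h0 h2
    obtain ⟨hs', t', m'', hex', ht', hr', hb', hj'⟩ := ihb w X hX m'
      (by rw [hb 0 (by decide), h0]) (by rwa [hb 2 (by decide)])
    rw [hb 2 (by decide)] at hs' hr'
    have hX2 := hX.two_le
    have h4 := le_pow_self hX.two_le D
    have h5 : X ^ d₁ ≤ X ^ D := Nat.pow_le_pow_right (by omega) (by omega)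
    have h5' : X ^ d₂ ≤ X ^ D := Nat.pow_le_pow_right (by omega) (by omega)
    have h6 := mul_pow_le hX.two_le 20 D
    have h8 := o.size_fn_le (a.eval w (m 2)) (b.eval w (m 2))
    have h9 : m'' 3 h = a.eval w (m 2) := by rw [hj' h (by omega), hr]
    refine ⟨by simp only [Term.eval]; omega, _, _, hex.seq (hex'.seq (Exec.write _ _ _ _)), ?_, ?_, ?_, ?_⟩
    · simp only [Expr.cost, Expr.eval, opCost, Op.cost_expr, Op.eval_expr, hr', h9]; omega
    · simp [Expr.eval, Term.eval, Op.eval_expr, h9, hr']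
    · intro b hb₂; simp [hb₂, hb', hb]
    · intro j hj₂; simp [Expr.eval, hj₂.ne, hj j hj₂, hj' j (by omega)]
  | sum v κ body ih =>
    intro h
    obtain ⟨d₁, hpow⟩ := lenPow_cost κ
    obtain ⟨d₂, ih⟩ := ih (h + 2)
    -- The body runs with the bound `X ^ (κ + 1)`, so its exponent `d₂` is multiplied by `κ + 1`.
    set D := d₁ + (κ + 1) * d₂ + Nat.size h + Nat.size (h + 1) + Nat.size (h + 2) + Nat.size v
      + κ + 1 with hD
    refine ⟨100 + (D + (100 + D)), fun w X hX m h0 h2 => ?_⟩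
    have hX2 := hX.two_le
    set M := (w.length + 1) ^ κ with hM
    have hMX : M ≤ X ^ κ := Nat.pow_le_pow_left hX.length_lt κ
    have h4 := le_pow_self hX2 D
    have h5 : X ^ d₁ ≤ X ^ D := Nat.pow_le_pow_right (by omega) (by omega)
    have h6 : (X ^ (κ + 1)) ^ d₂ ≤ X ^ D := by
      rw [← pow_mul]; exact Nat.pow_le_pow_right (by omega) (by omega)
    have h7 : X ^ κ ≤ X ^ D := Nat.pow_le_pow_right (by omega) (by omega)
    have h7' : X ^ κ ≤ X ^ (κ + 1) := Nat.pow_le_pow_right (by omega) (by omega)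
    have h8 : X ≤ X ^ D := Nat.le_self_pow (by omega) X
    have h8' : X ≤ X ^ (κ + 1) := Nat.le_self_pow (by omega) X
    have h9 := mul_pow_le hX2 100 D
    set F := fun i => body.eval w (Function.update (m 2) v i) with hF
    have henv : ∀ i ≤ M, ∀ l, Nat.size (Function.update (m 2) v i l) ≤ X ^ (κ + 1) := by
      intro i hi l
      by_cases hl : l = v
      · subst hl; simpa using (size_le_self i).trans (by omega)
      · simpa [hl] using (h2 l).trans h8'
    have hsizeF : ∀ i < M, Nat.size (F i) ≤ X ^ D := by
      intro i hi
      -- Only the bound on the value is wanted here, so any memory with the right input and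
      -- variables will do.
      have := (ih w _ (hX.pow κ) (Function.update m 2 (Function.update (m 2) v i)) (by simpa using h0)
        (by simpa using henv i hi.le)).1
      simp only [Function.update_self] at this
      exact this.trans h6
    have hsize : ∀ i ≤ M, Nat.size (∑ l ∈ Finset.range i, F l) ≤ 2 * X ^ D := by
      intro i hi
      have := size_sum_le i (X ^ D) F (fun l hl => hsizeF l (by omega))
      omega
    let Inv : ℕ → Memory → Prop := fun i m' =>
      m' 3 h = ∑ l ∈ Finset.range i, F l ∧ m' 3 (h + 1) = m 2 v ∧
      m' 2 = Function.update (m 2) v i ∧ (∀ b, b ≠ 3 → b ≠ 2 → m' b = m b) ∧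
      ∀ j < h, m' 3 j = m 3 j
    have hv := h2 v
    have hi0 : ∀ i ≤ M, Nat.size i ≤ X ^ D := fun i hi => (size_le_self i).trans (by omega)
    have hi1 : ∀ i ≤ M, Nat.size (i + 1) ≤ X ^ D + 1 := fun i hi =>
      (size_le_self (i + 1)).trans (by omega)
    have htest : ∀ i m', i ≤ M → Inv i m' →
        (Expr.add (.read 2 (.lit v)) (.lit 1)).eval m' = i + 1 ∧ (lenPow κ).eval m' = M ∧
        testCost m' (.add (.read 2 (.lit v)) (.lit 1)) (lenPow κ) ≤ 50 * X ^ D := by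
      intro i m' hi hI
      obtain ⟨a1, a2, a3, a4, a5⟩ := hI
      have a0 : m' 0 = cell w := by rw [a4 0 (by decide) (by decide), h0]
      have c1 := hpow w X hX m' a0
      have c2 := hi0 i hi
      have c3 := hi1 i hi
      have c4 := hi0 M le_rfl
      refine ⟨by simp [Expr.eval, a3], lenPow_eval κ a0, ?_⟩
      simp only [testCost, Expr.cost, Expr.eval, opCost, lenPow_eval κ a0, a3,
        Function.update_self, Nat.size_one, ← hM]
      omega
    have hbody : ∀ i m', i < M → Inv i m' → ∃ t m'', Exec
        (.seq (body.code (h + 2))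
        (.seq (.write 3 (.lit h) (.add (.read 3 (.lit h)) (.read 3 (.lit (h + 2)))))
          (.write 2 (.lit v) (.add (.read 2 (.lit v)) (.lit 1))))) m' t m'' ∧ t ≤ 50 * X ^ D ∧
        Inv (i + 1) m'' := by
      intro i m' hi hI
      obtain ⟨a1, a2, a3, a4, a5⟩ := hI
      have a0 : m' 0 = cell w := by rw [a4 0 (by decide) (by decide), h0]
      obtain ⟨-, t, m'', b1, b2, b3, b4, b5⟩ := ih w _ (hX.pow κ) m' a0
        (by rw [a3]; exact henv i hi.le)
      have e3 : m'' 3 (h + 2) = F i := by rw [b3, a3]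
      have e1 : m'' 3 h = ∑ l ∈ Finset.range i, F l := by rw [b5 h (by omega), a1]
      have e2 : m'' 2 v = i := by rw [b4 2 (by decide), a3]; simp
      refine ⟨_, _, b1.seq ((Exec.write _ _ _ _).seq (Exec.write _ _ _ _)), ?_, ?_, ?_, ?_, ?_, ?_⟩
      · have c1 := hsize i hi.le
        have c2 := hsize (i + 1) hi
        rw [Finset.sum_range_succ] at c2
        have c3 := hsizeF i hi
        have c4 := hi0 i hi.le
        have c5 := hi1 i hi.le
        simp [Expr.cost, Expr.eval, opCost, e1, e2, e3]
        omega
      · simp [Expr.eval, e1, e3, Finset.sum_range_succ]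
      · simp [Expr.eval, b5, a2]
      · simp [Expr.eval, b4, a3]
      · intro b hb hb'
        simp [hb, hb', b4, a4]
      · intro j hj
        simp [Expr.eval, hj.ne, b5 j (by omega), a5 j hj]
    have hstart : Inv 0 (Function.update (Function.update (Function.update m 3 (Function.update (m 3) h 0))
        3 (Function.update (Function.update (m 3) h 0) (h + 1) (m 2 v))) 2
        (Function.update (m 2) v 0)) := by
      refine ⟨by simp, by simp, by simp, ?_, ?_⟩
      · intro b hb hb'; simp [hb, hb']
      · intro j hj; simp [hj.ne, show j ≠ h + 1 by omega]
    obtain ⟨t, m', hex, ht, a1, a2, a3, a4, a5⟩ := exec_count htest hbody M 0 _ (by omega) hstart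
    have hbound : 100 * X ^ (D + (100 + D)) ≤ X ^ (100 + (D + (100 + D))) := mul_pow_le hX2 100 _
    have hbound' : X ^ D * X ^ (100 + D) = X ^ (D + (100 + D)) := (pow_add _ _ _).symm
    -- The number of rounds contributes one factor `X ^ D`, the cost of a round the other, with its
    -- constant `100` moved into the exponent.
    have hMC : M * (2 * (50 * X ^ D)) ≤ X ^ D * X ^ (100 + D) := by
      refine Nat.mul_le_mul (by omega) (by omega)
    have hpos : X ^ D ≤ X ^ (D + (100 + D)) := Nat.pow_le_pow_right (by omega) (by omega)
    have hpos' : X ^ (100 + D) ≤ X ^ (D + (100 + D)) := Nat.pow_le_pow_right (by omega) (by omega)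
    refine ⟨?_, _, _, (Exec.write _ _ _ _).seq ((Exec.write _ _ _ _).seq ((Exec.write _ _ _ _).seq
      (hex.seq (Exec.write _ _ _ _)))), ?_, ?_, ?_, ?_⟩
    · have : Nat.size ((Term.sum v κ body).eval w (m 2)) ≤ 2 * X ^ D := hsize M le_rfl
      omega
    · simp [Expr.cost, Expr.eval, opCost, a2]
      omega
    · simp [Expr.eval, Term.eval, a1, hF, hM]
    · intro b hb
      by_cases hb2 : b = 2
      · subst hb2; simp [Expr.eval, a2, a3]
      · simp [hb2, a4 b hb hb2]
    · intro j hj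
      simp [a5 j hj]

/-! ### Output words computed by terms -/

theorem length_le_wordSize (w : List ℕ) : w.length ≤ wordSize w := by
  induction w with
  | nil => simp
  | cons a w ih => simp only [wordSize, List.map_cons, List.sum_cons, List.length_cons] at *; omega

theorem fits_wordSize (w : List ℕ) : Fits w (wordSize w + 2) := by
  have hl := length_le_wordSize w
  refine ⟨by omega, by omega, fun j => ?_⟩
  rcases j with _ | j
  · exact (size_le_self _).trans (by simp [cell]; omega)
  · simp only [cell, List.getD_cons_succ]
    by_cases hj : j < w.length
    · rw [List.getD_eq_getElem _ _ hj]
      have : Nat.size w[j] + 1 ≤ wordSize w :=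
        List.single_le_sum (by simp) _ (List.mem_map.2 ⟨_, List.getElem_mem hj, rfl⟩)
      omega
    · rw [List.getD_eq_default _ _ (by omega)]; simp

theorem wordSize_le (w : List ℕ) (Z : ℕ) (h : ∀ x ∈ w, Nat.size x ≤ Z) :
    wordSize w ≤ w.length * (Z + 1) := by
  have := List.sum_le_card_nsmul (w.map fun x => Nat.size x + 1) (Z + 1)
    (by simpa using h)
  simpa [wordSize] using this

/-- If the length and the letters of the output are given by terms, then the output can be computed
in polynomial time. -/
theorem polyTime_of_terms {α : Type} {enc : α → List ℕ} {D : α → Prop} {R : α → List ℕ → Prop}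
    (len letter : Term) (κ : ℕ)
    (hlen : ∀ x, D x → len.eval (enc x) 0 ≤ ((enc x).length + 1) ^ κ)
    (hR : ∀ x, D x → R x ((List.range (len.eval (enc x) 0)).map fun i =>
      letter.eval (enc x) (Function.update 0 0 i))) :
    PolyTime enc D R := by
  obtain ⟨d₁, hpow⟩ := lenPow_cost κ
  obtain ⟨d₂, ih⟩ := letter.code_spec 0
  obtain ⟨d₃, ih'⟩ := len.code_spec 0
  set E := d₁ + (κ + 1) * d₂ + d₃ + κ + 1 with hE
  -- All `(l + 1) ^ κ` letters are written, including those beyond the end of the output. The length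
  -- is written last and determines which of them count.
  refine ⟨.seq (.whileLE (.add (.read 2 (.lit 0)) (.lit 1)) (lenPow κ)
      (.seq (letter.code 0)
        (.seq (.write 1 (.add (.read 2 (.lit 0)) (.lit 1)) (.read 3 (.lit 0)))
          (.write 2 (.lit 0) (.add (.read 2 (.lit 0)) (.lit 1))))))
      (.seq (.write 2 (.lit 0) (.lit 0)) (.seq (len.code 0) (.write 1 (.lit 0) (.read 3 (.lit 0))))),
    (Polynomial.X + 2) ^ (100 + (E + (100 + E))), fun x hx => ?_⟩
  set w := enc x with hw
  set X := wordSize w + 2 with hXw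
  have hX : Fits w X := fits_wordSize w
  have hX2 := hX.two_le
  set M := (w.length + 1) ^ κ with hM
  have hMX : M ≤ X ^ κ := Nat.pow_le_pow_left hX.length_lt κ
  have h5 : X ^ d₁ ≤ X ^ E := Nat.pow_le_pow_right (by omega) (by omega)
  have h5' : X ^ d₃ ≤ X ^ E := Nat.pow_le_pow_right (by omega) (by omega)
  have h6 : (X ^ (κ + 1)) ^ d₂ ≤ X ^ E := by
    rw [← pow_mul]; exact Nat.pow_le_pow_right (by omega) (by omega)
  have h7 : X ^ κ ≤ X ^ E := Nat.pow_le_pow_right (by omega) (by omega)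
  have h7' : X ^ κ ≤ X ^ (κ + 1) := Nat.pow_le_pow_right (by omega) (by omega)
  have h8 : X ≤ X ^ E := Nat.le_self_pow (by omega) X
  have h9 := mul_pow_le hX2 100 E
  set F := fun i => letter.eval w (Function.update 0 0 i) with hF
  have henv : ∀ i ≤ M, ∀ l, Nat.size (Function.update (0 : ℕ → ℕ) 0 i l) ≤ X ^ (κ + 1) := by
    intro i hi l
    by_cases hl : l = 0
    · subst hl; simpa using (size_le_self i).trans (by omega)
    · simp [hl]
  have hi0 : ∀ i ≤ M, Nat.size i ≤ X ^ E := fun i hi => (size_le_self i).trans (by omega)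
  have hi1 : ∀ i ≤ M, Nat.size (i + 1) ≤ X ^ E + 1 := fun i hi =>
    (size_le_self (i + 1)).trans (by omega)
  have hsizeF : ∀ i < M, Nat.size (F i) ≤ X ^ E := by
    intro i hi
    have := (ih w _ (hX.pow κ) (Function.update (fun _ => cell w) 2 (Function.update 0 0 i))
      (by simp) (by simpa using henv i hi.le)).1
    simp only [Function.update_self] at this
    exact this.trans h6
  let Inv : ℕ → Memory → Prop := fun i m =>
    m 0 = cell w ∧ m 2 = Function.update (0 : ℕ → ℕ) 0 i ∧ ∀ j < i, m 1 (j + 1) = F j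
  have htest : ∀ i m', i ≤ M → Inv i m' →
      (Expr.add (.read 2 (.lit 0)) (.lit 1)).eval m' = i + 1 ∧ (lenPow κ).eval m' = M ∧
      testCost m' (.add (.read 2 (.lit 0)) (.lit 1)) (lenPow κ) ≤ 50 * X ^ E := by
    intro i m' hi hI
    obtain ⟨a0, a3, a4⟩ := hI
    have c1 := hpow w X hX m' a0
    have c2 := hi0 i hi
    have c3 := hi1 i hi
    have c4 := hi0 M le_rfl
    refine ⟨by simp [Expr.eval, a3], lenPow_eval κ a0, ?_⟩
    simp only [testCost, Expr.cost, Expr.eval, opCost, lenPow_eval κ a0, a3,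
      Function.update_self, Nat.size_one, ← hM, Nat.size_zero]
    omega
  have hbody : ∀ i m', i < M → Inv i m' → ∃ t m'', Exec
      (.seq (letter.code 0)
        (.seq (.write 1 (.add (.read 2 (.lit 0)) (.lit 1)) (.read 3 (.lit 0)))
          (.write 2 (.lit 0) (.add (.read 2 (.lit 0)) (.lit 1))))) m' t m'' ∧ t ≤ 50 * X ^ E ∧
      Inv (i + 1) m'' := by
    intro i m' hi hI
    obtain ⟨a0, a3, a4⟩ := hI
    obtain ⟨-, t, m'', b1, b2, b3, b4, b5⟩ := ih w _ (hX.pow κ) m' a0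
      (by rw [a3]; exact henv i hi.le)
    have e3 : m'' 3 0 = F i := by rw [b3, a3]
    have e2 : m'' 2 0 = i := by rw [b4 2 (by decide), a3]; simp
    refine ⟨_, _, b1.seq ((Exec.write _ _ _ _).seq (Exec.write _ _ _ _)), ?_, ?_, ?_, ?_⟩
    · have c3 := hsizeF i hi
      have c4 := hi0 i hi.le
      have c5 := hi1 i hi.le
      simp [Expr.cost, Expr.eval, opCost, e2, e3]
      omega
    · simp [b4, a0]
    · simp [Expr.eval, b4, a3]
    · intro j hj
      rcases Nat.lt_succ_iff_lt_or_eq.1 hj with hj | rfl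
      · simp [Expr.eval, e2, hj.ne, b4, a4 j hj]
      · simp [Expr.eval, e2, e3]
  have hstart : Inv 0 (initMemory w) := by
    refine ⟨by ext j; simp [initMemory, cell], by ext j; simp [initMemory, Function.update_apply], by simp⟩
  obtain ⟨t, m, hex, ht, a0, a2, a1⟩ := exec_count htest hbody M 0 _ (by omega) hstart
  -- The loop leaves its counter in variable `0`; resetting it restores the zero environment in
  -- which `len` has to be evaluated.
  have hm2 : Function.update (m 2) 0 0 = 0 := by
    rw [a2, Function.update_idem, Function.update_eq_self_iff]; rfl
  obtain ⟨-, t', m', hex', ht', r1, r2, -⟩ := ih' w X hX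
    (Function.update m 2 (Function.update (m 2) 0 0)) (by simpa using a0) (by simp [hm2])
  simp only [Function.update_self, hm2] at r1
  have hL : len.eval w 0 ≤ M := hlen x hx
  have hout : output (Function.update m' 1 (Function.update (m' 1) 0 (m' 3 0))) =
      (List.range (len.eval w 0)).map F := by
    simp only [output, Function.update_self, r1]
    refine List.map_congr_left fun i hi => ?_
    have hi := List.mem_range.1 hi
    simp [r2, a1 i (by omega)]
  have hbound : 100 * X ^ (E + (100 + E)) ≤ X ^ (100 + (E + (100 + E))) := mul_pow_le hX2 100 _
  have hbound' : X ^ E * X ^ (100 + E) = X ^ (E + (100 + E)) := (pow_add _ _ _).symm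
  have hMC : M * (2 * (50 * X ^ E)) ≤ X ^ E * X ^ (100 + E) := Nat.mul_le_mul (by omega) (by omega)
  have hpos : X ^ E ≤ X ^ (E + (100 + E)) := Nat.pow_le_pow_right (by omega) (by omega)
  have hword : wordSize ((List.range (len.eval w 0)).map F) ≤ X ^ E * X ^ (100 + E) := by
    refine (wordSize_le _ (X ^ E) ?_).trans ?_
    · intro y hy
      obtain ⟨i, hi, rfl⟩ := List.mem_map.1 hy
      exact hsizeF i (by have := List.mem_range.1 hi; omega)
    · rw [List.length_map, List.length_range]
      exact Nat.mul_le_mul (by omega) (by omega)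
  refine ⟨_, _, hex.seq ((Exec.write _ _ _ _).seq (hex'.seq (Exec.write _ _ _ _))), ?_, ?_⟩
  · change _ + wordSize (output (Function.update m' 1 (Function.update (m' 1) 0 (m' 3 0)))) ≤ _
    rw [hout]
    have c1 := hi0 _ hL
    simp [Expr.cost, Expr.eval, opCost, r1]
    rw [← hXw]
    omega
  · change R x (output (Function.update m' 1 (Function.update (m' 1) 0 (m' 3 0))))
    rw [hout]
    exact hR x hx

/-! ### Derived terms -/

namespace Term

/-- Indicator of `a ≤ b`. -/
def le (a b : Term) : Term := .bin .sub (.lit 1) (.bin .sub a b)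

/-- Indicator of the negation. -/
def not (a : Term) : Term := .bin .sub (.lit 1) a

/-- Indicator of `a < b`. -/
def lt (a b : Term) : Term := le (.bin .add a (.lit 1)) b

/-- Conjunction. -/
def and (a b : Term) : Term := .bin .mul a b

/-- Disjunction. -/
def or (a b : Term) : Term := .bin .add a b

/-- Indicator of `a = b`. -/
def eq (a b : Term) : Term := and (le a b) (le b a)

/-- Indicator of `a ≠ 0`. -/
def truth (a : Term) : Term := not (not a)

/-- The sum over `i < b`, as long as `i` is below a power of the length of the input word. -/
def sumLT (v κ : ℕ) (b body : Term) : Term := .sum v κ (.bin .mul (lt (.var v) b) body)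

/-- Bounded universal quantification. -/
def ball (v κ : ℕ) (b body : Term) : Term := not (sumLT v κ b (not body))

/-- The term holds. -/
def Holds (w : List ℕ) (ρ : ℕ → ℕ) (a : Term) : Prop := a.eval w ρ ≠ 0

variable {w : List ℕ} {ρ : ℕ → ℕ} {a b body : Term} {v κ : ℕ}

@[simp] theorem eval_lit (n : ℕ) : (lit n).eval w ρ = n := rfl
@[simp] theorem eval_var (i : ℕ) : (var i).eval w ρ = ρ i := rfl
@[simp] theorem eval_inp : (inp a).eval w ρ = cell w (a.eval w ρ) := rfl
@[simp] theorem eval_add : (bin .add a b).eval w ρ = a.eval w ρ + b.eval w ρ := rfl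
@[simp] theorem eval_sub : (bin .sub a b).eval w ρ = a.eval w ρ - b.eval w ρ := rfl
@[simp] theorem eval_mul : (bin .mul a b).eval w ρ = a.eval w ρ * b.eval w ρ := rfl
@[simp] theorem eval_div : (bin .div a b).eval w ρ = a.eval w ρ / b.eval w ρ := rfl

/-- Truncated subtraction gives `a - b = 0` exactly for `a ≤ b`, and `1 - (a - b)` turns this into
an indicator. -/
theorem eval_le : (le a b).eval w ρ = if a.eval w ρ ≤ b.eval w ρ then 1 else 0 := by
  simp only [le, eval_sub, eval_lit]; split <;> omega

theorem eval_lt : (lt a b).eval w ρ = if a.eval w ρ < b.eval w ρ then 1 else 0 := by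
  simp only [lt, eval_le, eval_add, eval_lit, Nat.succ_le_iff]

open Classical in
theorem eval_not : (not a).eval w ρ = if a.Holds w ρ then 0 else 1 := by
  by_cases h : a.eval w ρ = 0 <;> simp [not, Holds, h]; omega

open Classical in
theorem eval_truth : (truth a).eval w ρ = if a.Holds w ρ then 1 else 0 := by
  by_cases h : a.eval w ρ = 0 <;> simp [truth, eval_not, Holds, h]

@[simp] theorem holds_le : (le a b).Holds w ρ ↔ a.eval w ρ ≤ b.eval w ρ := by
  simp [Holds, eval_le]
@[simp] theorem holds_lt : (lt a b).Holds w ρ ↔ a.eval w ρ < b.eval w ρ := by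
  simp [Holds, eval_lt]
@[simp] theorem holds_not : (not a).Holds w ρ ↔ ¬ a.Holds w ρ := by
  by_cases h : a.eval w ρ = 0 <;> simp [eval_not, Holds, h]
@[simp] theorem holds_and : (and a b).Holds w ρ ↔ a.Holds w ρ ∧ b.Holds w ρ := by
  simp [Holds, and]
@[simp] theorem holds_or : (or a b).Holds w ρ ↔ a.Holds w ρ ∨ b.Holds w ρ := by
  simp only [Holds, or, eval_add]; omega
@[simp] theorem holds_eq : (eq a b).Holds w ρ ↔ a.eval w ρ = b.eval w ρ := by
  simp [eq, le_antisymm_iff]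

/-- A sum over `i < b` if `b` does not depend on the summation variable. -/
theorem eval_sumLT {B : ℕ} (hb : ∀ i, b.eval w (Function.update ρ v i) = B)
    (hB : B ≤ (w.length + 1) ^ κ) :
    (sumLT v κ b body).eval w ρ = ∑ i ∈ Finset.range B, body.eval w (Function.update ρ v i) := by
  simp only [sumLT, eval, Op.fn, eval_lt, hb, Function.update_self, ite_mul, one_mul, zero_mul]
  rw [← Finset.sum_filter]
  refine Finset.sum_congr ?_ fun _ _ => rfl
  ext i; simp only [Finset.mem_filter, Finset.mem_range]; omega

theorem holds_ball {B : ℕ} (hb : ∀ i, b.eval w (Function.update ρ v i) = B)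
    (hB : B ≤ (w.length + 1) ^ κ) :
    (ball v κ b body).Holds w ρ ↔ ∀ i < B, body.Holds w (Function.update ρ v i) := by
  rw [ball, holds_not, Holds, eval_sumLT hb hB]
  simp [eval_not]

/-- The body is evaluated at the only point where the condition holds. -/
theorem eval_sum_unique {P : Term} {i₀ : ℕ} (hi₀ : i₀ < (w.length + 1) ^ κ)
    (h : ∀ i < (w.length + 1) ^ κ, P.Holds w (Function.update ρ v i) ↔ i = i₀) :
    (sum v κ (.bin .mul (truth P) body)).eval w ρ = body.eval w (Function.update ρ v i₀) := by
  simp only [eval, Op.fn]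
  rw [Finset.sum_eq_single i₀]
  · rw [eval_truth, if_pos ((h i₀ hi₀).2 rfl), one_mul]
  · intro i hi hne
    rw [eval_truth, if_neg (mt (h i (Finset.mem_range.1 hi)).1 hne), zero_mul]
  · intro h'; exact absurd (Finset.mem_range.2 hi₀) h'

end Term

/-- A property expressed by a term can be decided in polynomial time. -/
theorem polyTime_answer {α : Type} {enc : α → List ℕ} {D A : α → Prop} (a : Term)
    (h : ∀ x, D x → (a.Holds (enc x) 0 ↔ A x)) : PolyTime enc D (fun x => Answer (A x)) := by
  refine polyTime_of_terms (.lit 1) a.truth 1 (fun x _ => by simp) fun x hx => ?_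
  have h0 : Function.update (0 : ℕ → ℕ) 0 0 = 0 := Function.update_eq_self (0 : ℕ) (0 : ℕ → ℕ)
  simp only [Term.eval_lit, List.range_one, List.map_cons, List.map_nil, h0, Term.eval_truth,
    h x hx, Answer]
  by_cases hA : A x <;> simp [hA, h x hx]

/-- A fraction whose numerator and denominator are given by terms can be computed in polynomial
time. -/
theorem polyTime_fraction {α : Type} {enc : α → List ℕ} {D : α → Prop} {val : α → ℚ}
    (u v : Term) (hne : ∀ x, enc x ≠ []) (hv : ∀ x, D x → ∀ ρ, 0 < v.eval (enc x) ρ)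
    (h : ∀ x, D x → ∀ ρ ρ', val x = (u.eval (enc x) ρ : ℚ) / v.eval (enc x) ρ') :
    PolyTime enc D (fun x w => ∃ a b : ℕ, w = [a, b] ∧ 0 < b ∧ val x = (a : ℚ) / b) := by
  -- Letter `i` is `(1 - i) * u + i * v`. The two letters are evaluated in different environments,
  -- hence the independent `ρ` and `ρ'` in the hypothesis.
  refine polyTime_of_terms (.lit 2)
    (.bin .add (.bin .mul (.bin .sub (.lit 1) (.var 0)) u) (.bin .mul (.var 0) v)) 2
    (fun x hx => ?_) fun x hx => ?_
  · have := List.length_pos_of_ne_nil (hne x)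
    simp only [Term.eval_lit]
    nlinarith
  · refine ⟨u.eval (enc x) (Function.update 0 0 0), v.eval (enc x) (Function.update 0 0 1), ?_,
      hv x hx _, h x hx _ _⟩
    simp [List.range_succ]

end RAM

namespace AFS

/-! ### Ranks of features -/

/-- For two sets of size `k` the Dice dissimilarity is `1 - |F ∩ F'| / k`, and an integer is at most
`(1 - τ) k` if and only if it is at most the floor. The real threshold thus enters feasibility only
through one natural number. -/
theorem isAlternative_iff {n k : ℕ} {τ : ℝ} (hk : 1 ≤ k) (hτ : τ ≤ 1) {F F' : Finset (Fin n)}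
    (hF : F.card = k) (hF' : F'.card = k) :
    IsAlternative τ F F' ↔ (F ∩ F').card ≤ ⌊(1 - τ) * k⌋₊ := by
  have hk' : (0 : ℝ) < k := by exact_mod_cast hk
  rw [IsAlternative, dice, hF, hF', Nat.le_floor_iff (mul_nonneg (by linarith) hk'.le),
    le_sub_comm, ← two_mul, mul_div_mul_left _ _ two_ne_zero, div_le_iff₀ hk']

theorem floor_add_ceil {τ : ℝ} (h0 : 0 ≤ τ) (h1 : τ ≤ 1) (k : ℕ) :
    ⌊(1 - τ) * k⌋₊ + ⌈τ * k⌉₊ = k := by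
  have hk : (0 : ℝ) ≤ k := k.cast_nonneg
  have hc : ⌈τ * k⌉₊ ≤ k := Nat.ceil_le.2 (by nlinarith)
  have : ⌊(1 - τ) * k⌋₊ = k - ⌈τ * k⌉₊ := by
    rw [Nat.floor_eq_iff (mul_nonneg (by linarith) hk), Nat.cast_sub hc]
    have h2 := Nat.le_ceil (τ * k)
    have h3 := Nat.ceil_lt_add_one (mul_nonneg h0 hk)
    constructor <;> linarith
  omega

variable {n : ℕ}

/-- Feature `i` precedes feature `j` in the order of descending quality. -/
def Precedes (q : Fin n → ℚ) (i j : Fin n) : Prop := q j < q i ∨ (q i = q j ∧ i < j)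

instance (q : Fin n → ℚ) : DecidableRel (Precedes q) := fun _ _ => inferInstanceAs (Decidable (_ ∨ _))

/-- The number of features that precede feature `j`. -/
def rank (q : Fin n → ℚ) (j : Fin n) : ℕ := (Finset.univ.filter fun i => Precedes q i j).card

theorem Precedes.trans {q : Fin n → ℚ} {i j l : Fin n} (h : Precedes q i j) (h' : Precedes q j l) :
    Precedes q i l := by
  rcases h with h | ⟨h, h₂⟩ <;> rcases h' with h' | ⟨h', h₂'⟩
  · exact .inl (h'.trans h)
  · exact .inl (h'.symm ▸ h)
  · exact .inl (h ▸ h')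
  · exact .inr ⟨h.trans h', h₂.trans h₂'⟩

theorem Precedes.irrefl {q : Fin n → ℚ} {i : Fin n} : ¬ Precedes q i i := by
  rintro (h | ⟨-, h⟩) <;> exact lt_irrefl _ h

/-- The inserted feature stops in front of the first one of no larger quality. Since its index is
smaller than all indices in the list, ties are resolved by index. -/
theorem pairwise_orderedInsert (q : Fin n → ℚ) (a : Fin n) :
    ∀ l : List (Fin n), l.Pairwise (Precedes q) → (∀ b ∈ l, a < b) →
      (l.orderedInsert (fun i j => q j ≤ q i) a).Pairwise (Precedes q)
  | [], _, _ => by simp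
  | b :: l, hl, ha => by
    rw [List.orderedInsert]
    have hb : ∀ c ∈ l, Precedes q b c := (List.pairwise_cons.1 hl).1
    split_ifs with hab
    · have h1 : Precedes q a b := by
        rcases hab.lt_or_eq with h | h
        · exact .inl h
        · exact .inr ⟨h.symm, ha b (by simp)⟩
      refine List.pairwise_cons.2 ⟨fun c hc => ?_, hl⟩
      rcases List.mem_cons.1 hc with rfl | hc
      · exact h1
      · exact h1.trans (hb c hc)
    · refine List.pairwise_cons.2 ⟨fun c hc => ?_,
        pairwise_orderedInsert q a l hl.of_cons fun c hc => ha c (by simp [hc])⟩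
      rcases (List.mem_orderedInsert _).1 hc with rfl | hc
      · exact .inl (not_le.1 hab)
      · exact hb c hc

theorem pairwise_insertionSort (q : Fin n → ℚ) :
    ∀ l : List (Fin n), l.Pairwise (· < ·) →
      (l.insertionSort fun i j => q j ≤ q i).Pairwise (Precedes q)
  | [], _ => by simp
  | a :: l, hl => by
    rw [List.insertionSort_cons]
    refine pairwise_orderedInsert q a _ (pairwise_insertionSort q l hl.of_cons) fun b hb => ?_
    exact List.rel_of_pairwise_cons hl ((List.mem_insertionSort _).1 hb)

theorem pairwise_sortIndices (q : Fin n → ℚ) : (sortIndices q).Pairwise (Precedes q) :=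
  pairwise_insertionSort q _ (List.pairwise_lt_finRange n)

theorem mem_sortIndices (q : Fin n → ℚ) (j : Fin n) : j ∈ sortIndices q :=
  (List.mem_insertionSort _).2 (List.mem_finRange j)

theorem length_sortIndices (q : Fin n → ℚ) : (sortIndices q).length = n := by
  simp [sortIndices]

theorem nodup_sortIndices (q : Fin n → ℚ) : (sortIndices q).Nodup :=
  (List.perm_insertionSort _ _).nodup_iff.2 (List.nodup_finRange n)

theorem card_filter_idxOf_lt {l : List (Fin n)} (hl : l.Nodup) (hmem : ∀ j, j ∈ l) {m : ℕ}
    (hm : m ≤ l.length) : (Finset.univ.filter fun i => l.idxOf i < m).card = m := by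
  have : (Finset.univ.filter fun i => l.idxOf i < m).image l.idxOf = Finset.range m := by
    ext t
    simp only [Finset.mem_image, Finset.mem_filter, Finset.mem_univ, true_and, Finset.mem_range]
    constructor
    · rintro ⟨i, hi, rfl⟩; exact hi
    · intro ht
      exact ⟨l[t], by rw [hl.idxOf_getElem]; exact ht, hl.idxOf_getElem t _⟩
  rw [← Finset.card_image_of_injOn (f := l.idxOf), this, Finset.card_range]
  intro i _ i' _ h
  exact (List.idxOf_inj (hmem i)).1 h

/-- The sorted list is strictly increasing for `Precedes`, so the features at earlier positions are
exactly the predecessors. This replaces the sorting algorithm by a count that a bounded sum can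
express. -/
theorem idxOf_sortIndices (q : Fin n → ℚ) (j : Fin n) : (sortIndices q).idxOf j = rank q j := by
  have hp := List.pairwise_iff_getElem.1 (pairwise_sortIndices q)
  have key : ∀ i j, (sortIndices q).idxOf i < (sortIndices q).idxOf j → Precedes q i j := by
    intro i j h
    have := hp _ _ (List.idxOf_lt_length_of_mem (mem_sortIndices q i))
      (List.idxOf_lt_length_of_mem (mem_sortIndices q j)) h
    simpa using this
  rw [rank, ← card_filter_idxOf_lt (nodup_sortIndices q) (mem_sortIndices q)
    (List.idxOf_lt_length_of_mem (mem_sortIndices q j)).le]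
  congr 1
  ext i
  simp only [Finset.mem_filter, Finset.mem_univ, true_and]
  refine ⟨key i j, fun h => ?_⟩
  by_contra hlt
  rcases (not_lt.1 hlt).lt_or_eq with h' | h'
  · exact Precedes.irrefl (h.trans (key j i h'))
  · rw [List.idxOf_inj (mem_sortIndices q j)] at h'
    subst h'; exact Precedes.irrefl h

theorem rank_injective (q : Fin n → ℚ) : Function.Injective (rank q) := by
  intro i j h
  rw [← idxOf_sortIndices, ← idxOf_sortIndices] at h
  exact (List.idxOf_inj (mem_sortIndices q i)).1 h

theorem exists_rank_eq (q : Fin n → ℚ) {r : ℕ} (hr : r < n) : ∃ j, rank q j = r := by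
  have hr' : r < (sortIndices q).length := by rwa [length_sortIndices]
  exact ⟨(sortIndices q)[r], by rw [← idxOf_sortIndices, (nodup_sortIndices q).idxOf_getElem]⟩

/-- If `q i < q j`, the predecessors of `j` are also predecessors of `i`, and `j` itself is a
further one; so the rank of `i` would be larger. -/
theorem le_of_rank_le {q : Fin n → ℚ} {i j : Fin n} (h : rank q i ≤ rank q j) : q j ≤ q i := by
  by_contra hlt
  have hji : Precedes q j i := .inl (not_le.1 hlt)
  refine absurd h (not_le.2 (Finset.card_lt_card ?_))
  refine ⟨fun l hl => ?_, fun hs => ?_⟩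
  · simp only [Finset.mem_filter, Finset.mem_univ, true_and] at *
    exact hl.trans hji
  · have := @hs j (by simpa using hji)
    simp only [Finset.mem_filter, Finset.mem_univ, true_and] at this
    exact Precedes.irrefl this

/-! ### Decision vectors given by ranks, and the averaging inequality -/

/-- The decision vector that selects the features whose rank is in `S`. -/
def rankSelection (q : Fin n → ℚ) (S : Finset ℕ) : Selection n := fun j => decide (rank q j ∈ S)

theorem mem_featureSet {s : Selection n} {j : Fin n} : j ∈ featureSet s ↔ s j = true := by
  simp [featureSet]

theorem mem_featureSet_rankSelection {q : Fin n → ℚ} {S : Finset ℕ} {j : Fin n} :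
    j ∈ featureSet (rankSelection q S) ↔ rank q j ∈ S := by
  simp [mem_featureSet, rankSelection]

theorem card_rankSelection (q : Fin n → ℚ) {S : Finset ℕ} (hS : ∀ r ∈ S, r < n) :
    (featureSet (rankSelection q S)).card = S.card := by
  rw [← Finset.card_image_of_injective _ (rank_injective q)]
  congr 1
  ext r
  simp only [Finset.mem_image, mem_featureSet_rankSelection]
  constructor
  · rintro ⟨j, hj, rfl⟩; exact hj
  · intro hr
    obtain ⟨j, rfl⟩ := exists_rank_eq q (hS r hr)
    exact ⟨j, hr, rfl⟩

theorem rankSelection_inter (q : Fin n → ℚ) (S T : Finset ℕ) :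
    featureSet (rankSelection q S) ∩ featureSet (rankSelection q T) =
      featureSet (rankSelection q (S ∩ T)) := by
  ext j; simp [mem_featureSet_rankSelection]

theorem univariateQuality_eq_sum (q : Fin n → ℚ) (s : Selection n) :
    univariateQuality q s = ∑ j ∈ featureSet s, q j := by
  simp [univariateQuality, featureSet, Finset.sum_filter]

/-- The average quality of the best `p` features is at least the average quality of `k ≥ p`
features. -/
theorem mul_sum_le_mul_sum_rank_lt {q : Fin n → ℚ} (hq : ∀ j, 0 ≤ q j) {F : Finset (Fin n)} {k p : ℕ}
    (hF : F.card = k) (hp : p ≤ k) :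
    (p : ℚ) * ∑ j ∈ F, q j ≤
      k * ∑ j ∈ featureSet (rankSelection q (Finset.range p)), q j := by
  set A := featureSet (rankSelection q (Finset.range p)) with hA
  have hkn : k ≤ n := by rw [← hF]; simpa using Finset.card_le_univ F
  have hAc : A.card = p := by
    rw [hA, card_rankSelection q (fun r hr => by have := Finset.mem_range.1 hr; omega)]; simp
  rcases Nat.eq_zero_or_pos p with rfl | hpos
  · simpa using mul_nonneg k.cast_nonneg (Finset.sum_nonneg fun j _ => hq j)
  -- The `p`-th best feature `t` is the separator: features in `A` are at least as good, features
  -- outside at most as good.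
  obtain ⟨t, ht⟩ := exists_rank_eq q (show p - 1 < n by omega)
  have h1 : ∀ j ∈ A, q t ≤ q j := fun j hj => by
    have := Finset.mem_range.1 (mem_featureSet_rankSelection.1 hj)
    exact le_of_rank_le (by omega)
  have h2 : ∀ j ∉ A, q j ≤ q t := fun j hj => by
    have := mt Finset.mem_range.2 (mt mem_featureSet_rankSelection.2 hj)
    exact le_of_rank_le (by omega)
  have e1 := Finset.sum_inter_add_sum_sdiff F A q
  have e2 := Finset.sum_inter_add_sum_sdiff A F q
  have c1 := Finset.card_inter_add_card_sdiff F A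
  have c2 := Finset.card_inter_add_card_sdiff A F
  rw [Finset.inter_comm A F] at e2 c2
  have b1 : ∑ j ∈ F \ A, q j ≤ (F \ A).card * q t := by
    rw [← nsmul_eq_mul]
    exact Finset.sum_le_card_nsmul _ _ _ fun j hj => h2 j (Finset.mem_sdiff.1 hj).2
  have b2 : ((A \ F).card : ℚ) * q t ≤ ∑ j ∈ A \ F, q j := by
    rw [← nsmul_eq_mul]
    exact Finset.card_nsmul_le_sum _ _ _ fun j hj => h1 j (Finset.mem_sdiff.1 hj).1
  have b3 : ((F ∩ A).card : ℚ) * q t ≤ ∑ j ∈ F ∩ A, q j := by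
    rw [← nsmul_eq_mul]
    exact Finset.card_nsmul_le_sum _ _ _ fun j hj => h1 j (Finset.mem_inter.1 hj).2
  have c1' : ((F ∩ A).card : ℚ) + (F \ A).card = k := by rw [← hF]; exact_mod_cast c1
  have c2' : ((F ∩ A).card : ℚ) + (A \ F).card = p := by rw [← hAc]; exact_mod_cast c2
  have hpk : (p : ℚ) ≤ k := by exact_mod_cast hp
  have hp0 : (0 : ℚ) ≤ p := p.cast_nonneg
  rw [← e1, ← e2]
  generalize ((F ∩ A).card : ℚ) = I at *
  have f1 := mul_le_mul_of_nonneg_left b1 hp0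
  have f2 := mul_le_mul_of_nonneg_left b2 (hp0.trans hpk)
  have f3 := mul_le_mul_of_nonneg_left b3 (sub_nonneg.2 hpk)
  have hd1 : ((F \ A).card : ℚ) = k - I := by linarith
  have hd2 : ((A \ F).card : ℚ) = p - I := by linarith
  rw [hd1] at f1
  rw [hd2] at f2
  -- Adding `f1`, `f2` and `f3`, the multiples of `q t` cancel: `k (p - I) - p (k - I) + (k - p) I =
  -- 0`.
  nlinarith

/-! ### Quality of Greedy Replacement Search -/

/-- The ranks of the features in the `i`-th result of Greedy Replacement Search: the first `p`
ones and the `i`-th block of length `c`. -/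
def blockRanks (p c i : ℕ) : Finset ℕ := Finset.range p ∪ Finset.Ico (p + i * c) (p + i * c + c)

theorem mem_take_drop_iff {α : Type*} [DecidableEq α] {l : List α} (hl : l.Nodup) {m a : ℕ} {j : α}
    (hj : j ∈ l) : j ∈ (l.drop m).take a ↔ m ≤ l.idxOf j ∧ l.idxOf j < m + a := by
  have hlt := List.idxOf_lt_length_of_mem hj
  simp only [List.mem_iff_getElem, List.length_take, List.length_drop, List.getElem_take,
    List.getElem_drop]
  constructor
  · rintro ⟨t, ht, rfl⟩
    rw [hl.idxOf_getElem]; omega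
  · intro h
    refine ⟨l.idxOf j - m, by omega, ?_⟩
    simp only [Nat.add_sub_cancel' h.1, List.getElem_idxOf]

theorem greedySelection_eq (q : Fin n → ℚ) (k : ℕ) (τ : ℝ) (i : ℕ) :
    greedySelection q k τ i = rankSelection q (blockRanks ⌊(1 - τ) * k⌋₊ ⌈τ * k⌉₊ i) := by
  funext j
  have hj := mem_sortIndices q j
  simp [greedySelection, rankSelection, blockRanks, List.mem_take_iff_idxOf_lt hj,
    mem_take_drop_iff (nodup_sortIndices q) hj, idxOf_sortIndices]

theorem card_blockRanks (p c i : ℕ) : (blockRanks p c i).card = p + c := by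
  rw [blockRanks, Finset.card_union_of_disjoint]
  · simp
  · rw [Finset.disjoint_left]; intro r hr hr'
    simp only [Finset.mem_range, Finset.mem_Ico] at *; omega

theorem mem_blockRanks_lt {p c i r : ℕ} (h : r ∈ blockRanks p c i) : r < p + c + i * c := by
  simp only [blockRanks, Finset.mem_union, Finset.mem_range, Finset.mem_Ico] at h; omega

/-- Different blocks are disjoint, so only the common prefix remains. -/
theorem card_blockRanks_inter_le {p c i i' : ℕ} (h : i ≠ i') :
    (blockRanks p c i ∩ blockRanks p c i').card ≤ p := by
  refine (Finset.card_le_card (t := Finset.range p) fun r hr => ?_).trans_eq (Finset.card_range p)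
  simp only [blockRanks, Finset.mem_inter, Finset.mem_union, Finset.mem_range, Finset.mem_Ico] at *
  by_contra hrp
  -- A rank in both blocks would force `i < i' + 1` and `i' < i + 1`, that is, `i = i'`.
  have h1 : i * c < (i' + 1) * c := by rw [Nat.succ_mul]; omega
  have h2 : i' * c < (i + 1) * c := by rw [Nat.succ_mul]; omega
  have := lt_of_mul_lt_mul_right h1 (Nat.zero_le c)
  have := lt_of_mul_lt_mul_right h2 (Nat.zero_le c)
  omega

theorem card_greedySelection {q : Fin n → ℚ} {k : ℕ} {τ : ℝ} (h0 : 0 ≤ τ) (h1 : τ ≤ 1) {i : ℕ}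
    (hi : k + i * ⌈τ * k⌉₊ ≤ n) : (featureSet (greedySelection q k τ i)).card = k := by
  have hpc := floor_add_ceil h0 h1 k
  rw [greedySelection_eq, card_rankSelection, card_blockRanks, hpc]
  intro r hr
  have := mem_blockRanks_lt hr
  omega

theorem isAlternative_greedySelection {q : Fin n → ℚ} {k : ℕ} {τ : ℝ} (hk : 1 ≤ k) (h0 : 0 ≤ τ)
    (h1 : τ ≤ 1) {i i' : ℕ} (hi : k + i * ⌈τ * k⌉₊ ≤ n) (hi' : k + i' * ⌈τ * k⌉₊ ≤ n)
    (hii : i ≠ i') :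
    IsAlternative τ (featureSet (greedySelection q k τ i))
      (featureSet (greedySelection q k τ i')) := by
  have hpc := floor_add_ceil h0 h1 k
  rw [isAlternative_iff hk h1 (card_greedySelection h0 h1 hi) (card_greedySelection h0 h1 hi'),
    greedySelection_eq, greedySelection_eq, rankSelection_inter, card_rankSelection]
  · exact card_blockRanks_inter_le hii
  · intro r hr
    have := mem_blockRanks_lt (Finset.mem_inter.1 hr).1
    omega

/-- The prefix alone satisfies the bound, by averaging; the block only adds non-negative quality. As
`s` needs nothing but its size, the bound holds for every search history. -/
theorem ratio_mul_le_greedySelection {q : Fin n → ℚ} (hq : ∀ j, 0 ≤ q j) {k : ℕ} {τ : ℝ}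
    (hk : 1 ≤ k) (h0 : 0 ≤ τ) (h1 : τ ≤ 1) (i : ℕ) {s : Selection n}
    (hs : (featureSet s).card = k) :
    ratio k τ * univariateQuality q s ≤ univariateQuality q (greedySelection q k τ i) := by
  have hpc := floor_add_ceil h0 h1 k
  have hk' : (0 : ℚ) < k := by exact_mod_cast hk
  have h2 := mul_sum_le_mul_sum_rank_lt hq hs (p := ⌊(1 - τ) * k⌋₊) (by omega)
  rw [ratio, univariateQuality_eq_sum, univariateQuality_eq_sum, div_mul_eq_mul_div,
    div_le_iff₀' hk']
  refine h2.trans (mul_le_mul_of_nonneg_left ?_ hk'.le)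
  refine Finset.sum_le_sum_of_subset_of_nonneg (fun j hj => ?_) fun j _ _ => hq j
  rw [greedySelection_eq, mem_featureSet_rankSelection]
  exact Finset.mem_union_left _ (mem_featureSet_rankSelection.1 hj)

theorem Qualities.q_nonneg (D : Qualities) (j : Fin D.n) : 0 ≤ D.q j := by
  unfold Qualities.q; positivity

theorem greedyReplacement_eq (q : Fin n → ℚ) {k a : ℕ} {τ : ℝ} (h : k + a * ⌈τ * k⌉₊ ≤ n) :
    greedyReplacement q k a τ = (List.range (a + 1)).map (greedySelection q k τ) := by
  rw [greedyReplacement, List.filter_eq_self.2]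
  intro i hi
  have : i * ⌈τ * k⌉₊ ≤ a * ⌈τ * k⌉₊ :=
    Nat.mul_le_mul_right _ (Nat.lt_succ_iff.1 (List.mem_range.1 hi))
  simp; omega

theorem greedyTuple_eq {x : SimInst} {k : ℕ} {τ : ℝ} (h : k + x.a * ⌈τ * k⌉₊ ≤ x.n)
    (i : Fin (x.a + 1)) : greedyTuple k τ x i = greedySelection x.q k τ i := by
  rw [greedyTuple, greedyReplacement_eq _ h, List.getD_eq_getElem _ _ (by simp; omega)]
  simp

/-! ### Disjoint feature sets -/

/-- The ranks `r < m * k` with remainder `i` modulo `m`. -/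
def strideRanks (k m i : ℕ) : Finset ℕ := (Finset.range (m * k)).filter fun r => r % m = i

theorem card_strideRanks {k m i : ℕ} (hi : i < m) : (strideRanks k m i).card = k := by
  have : strideRanks k m i = (Finset.range k).image fun t => i + m * t := by
    ext r
    simp only [strideRanks, Finset.mem_filter, Finset.mem_range, Finset.mem_image]
    constructor
    · rintro ⟨h1, h2⟩
      exact ⟨r / m, Nat.div_lt_of_lt_mul h1, by rw [← h2]; exact Nat.mod_add_div r m⟩
    · rintro ⟨t, ht, rfl⟩
      refine ⟨?_, by rw [Nat.add_mul_mod_self_left, Nat.mod_eq_of_lt hi]⟩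
      have : m * (t + 1) ≤ m * k := Nat.mul_le_mul_left _ ht
      rw [Nat.mul_succ] at this; omega
  rw [this, Finset.card_image_of_injective, Finset.card_range]
  intro t t' h
  have h' : m * t = m * t' := by simpa using h
  exact Nat.eq_of_mul_eq_mul_left (by omega) h'

/-- The tuple of disjoint decision vectors that distributes the best features cyclically. -/
def strideTuple (k : ℕ) (x : SimInst) : Fin (x.a + 1) → Selection x.n :=
  fun i => rankSelection x.q (strideRanks k (x.a + 1) i)

theorem strideRanks_inter {k m i i' : ℕ} (h : i ≠ i') : strideRanks k m i ∩ strideRanks k m i' = ∅ := by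
  ext r
  simp only [strideRanks, Finset.mem_inter, Finset.mem_filter]
  simp; omega

theorem mem_strideRanks_lt {k m i r : ℕ} (h : r ∈ strideRanks k m i) : r < m * k :=
  Finset.mem_range.1 (Finset.mem_filter.1 h).1

theorem card_strideTuple {k : ℕ} {x : SimInst} (h : (x.a + 1) * k ≤ x.n) (i : Fin (x.a + 1)) :
    (featureSet (strideTuple k x i)).card = k := by
  rw [strideTuple, card_rankSelection, card_strideRanks i.2]
  exact fun r hr => (mem_strideRanks_lt hr).trans_le h

theorem strideTuple_inter (k : ℕ) (x : SimInst) {i i' : Fin (x.a + 1)} (h : i ≠ i') :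
    featureSet (strideTuple k x i) ∩ featureSet (strideTuple k x i') = ∅ := by
  rw [strideTuple, strideTuple, rankSelection_inter, strideRanks_inter (by omega)]
  ext j; simp [mem_featureSet_rankSelection]

/-- The total quality of disjoint sets is the quality of their union, a set of `(a + 1) k` features;
the union of the stride sets consists of the best ones. -/
theorem sum_le_sum_strideTuple {k : ℕ} (hk : 1 ≤ k) {x : SimInst}
    {y : Fin (x.a + 1) → Selection x.n} (hy : ∀ i, (featureSet (y i)).card = k)
    (hdisj : ∀ i i', i ≠ i' → featureSet (y i) ∩ featureSet (y i') = ∅) :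
    ∑ i, univariateQuality x.q (y i) ≤ ∑ i, univariateQuality x.q (strideTuple k x i) := by
  have hd : ((Finset.univ : Finset (Fin (x.a + 1))) : Set _).PairwiseDisjoint
      fun i => featureSet (y i) := fun i _ i' _ h => Finset.disjoint_iff_inter_eq_empty.2 (hdisj i i' h)
  have hd' : ((Finset.univ : Finset (Fin (x.a + 1))) : Set _).PairwiseDisjoint
      fun i => featureSet (strideTuple k x i) :=
    fun i _ i' _ h => Finset.disjoint_iff_inter_eq_empty.2 (strideTuple_inter k x h)
  have hcard : (Finset.univ.biUnion fun i => featureSet (y i)).card = (x.a + 1) * k := by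
    rw [Finset.card_biUnion hd]; simp [hy]
  have hU : (Finset.univ.biUnion fun i => featureSet (strideTuple k x i)) =
      featureSet (rankSelection x.q (Finset.range ((x.a + 1) * k))) := by
    ext j
    simp only [Finset.mem_biUnion, Finset.mem_univ, true_and, strideTuple,
      mem_featureSet_rankSelection, strideRanks, Finset.mem_filter]
    exact ⟨fun ⟨i, hi⟩ => hi.1, fun h => ⟨⟨_, Nat.mod_lt _ x.a.succ_pos⟩, h, rfl⟩⟩
  have h := mul_sum_le_mul_sum_rank_lt x.q_nonneg hcard le_rfl
  rw [Finset.sum_biUnion hd, ← hU, Finset.sum_biUnion hd'] at h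
  simp only [univariateQuality_eq_sum]
  exact le_of_mul_le_mul_left h (by exact_mod_cast Nat.mul_pos x.a.succ_pos hk)

/-- The best features of the `a + 1` disjoint sets are distinct, so one of them has rank at least
`a`. Every stride set contains a feature of rank at most `a`, which is at least as good, and a set
of size `k` has at most `k` times the quality of its best feature. -/
theorem exists_le_mul_strideTuple {k : ℕ} (hk : 1 ≤ k) {x : SimInst} (h : (x.a + 1) * k ≤ x.n)
    {y : Fin (x.a + 1) → Selection x.n} (hy : ∀ i, (featureSet (y i)).card = k)
    (hdisj : ∀ i i', i ≠ i' → featureSet (y i) ∩ featureSet (y i') = ∅) (i : Fin (x.a + 1)) :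
    ∃ i', univariateQuality x.q (y i') ≤ k * univariateQuality x.q (strideTuple k x i) := by
  have hbest : ∀ i, ∃ j ∈ featureSet (y i), univariateQuality x.q (y i) ≤ k * x.q j := by
    intro i
    obtain ⟨j, hj, hmax⟩ := Finset.exists_max_image (featureSet (y i)) x.q
      (Finset.card_pos.1 (by rw [hy]; exact hk))
    refine ⟨j, hj, ?_⟩
    rw [univariateQuality_eq_sum, ← hy i, ← nsmul_eq_mul]
    exact Finset.sum_le_card_nsmul _ _ _ hmax
  choose b hb hbq using hbest
  have hinj : Function.Injective b := by
    intro i i' hii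
    by_contra hne
    have := Finset.mem_inter.2 ⟨hb i, hii ▸ hb i'⟩
    rw [hdisj i i' hne] at this
    simp at this
  obtain ⟨i', hi'⟩ : ∃ i', x.a ≤ rank x.q (b i') := by
    by_contra! hlt
    -- Pigeonhole: `a + 1` different features cannot all have ranks below `a`.
    have hc := Finset.card_le_card_of_injOn (s := Finset.univ) (t := Finset.range x.a)
      (fun i => rank x.q (b i)) (fun i _ => by simpa using hlt i)
      (fun i _ i' _ hii => hinj (rank_injective _ hii))
    simp at hc
  have hi : (i : ℕ) < (x.a + 1) * k := i.2.trans_le (Nat.le_mul_of_pos_right _ hk)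
  obtain ⟨t, ht⟩ := exists_rank_eq x.q (hi.trans_le h)
  refine ⟨i', (hbq i').trans (mul_le_mul_of_nonneg_left ?_ k.cast_nonneg)⟩
  have hmem : t ∈ featureSet (strideTuple k x i) := by
    rw [strideTuple, mem_featureSet_rankSelection, ht, strideRanks, Finset.mem_filter]
    exact ⟨Finset.mem_range.2 hi, Nat.mod_eq_of_lt i.2⟩
  rw [univariateQuality_eq_sum]
  exact (le_of_rank_le (by omega)).trans
    (Finset.single_le_sum (f := x.q) (fun j _ => x.q_nonneg j) hmem)

end AFS

namespace AFS

open RAM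

/-! ### Layout of the input words -/

/-- The word `w` contains, after `o` letters, the encoding of the qualities `D` with the number `m`,
followed by the letters of `rest`. -/
structure Layout (w : List ℕ) (o : ℕ) (D : Qualities) (m : ℕ) (rest : List ℕ) : Prop where
  den : cell w (o + 1) = D.den
  n : cell w (o + 2) = D.n
  m : cell w (o + 3) = m
  num : ∀ j : Fin D.n, cell w (o + 4 + j) = D.num j
  length : w.length = o + 3 + D.n + rest.length
  rest : ∀ i, cell w (o + 4 + D.n + i) = rest.getD i 0

/-- The shift by one is due to cell `0`, which holds the length of the word. -/
theorem cell_append (pre u : List ℕ) (i : ℕ) : cell (pre ++ u) (pre.length + 1 + i) = u.getD i 0 := by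
  rw [cell, Nat.add_right_comm, List.getD_cons_succ, List.getD_append_right _ _ _ _ (by omega)]
  simp

theorem layout_append (pre : List ℕ) (D : Qualities) (m : ℕ) (rest : List ℕ) :
    Layout (pre ++ D.den :: D.n :: m :: (List.ofFn D.num ++ rest)) pre.length D m rest where
  den := cell_append pre _ 0
  n := cell_append pre _ 1
  m := cell_append pre _ 2
  num j := by
    have := cell_append pre (D.den :: D.n :: m :: (List.ofFn D.num ++ rest)) (3 + j)
    rw [show pre.length + 4 + (j : ℕ) = pre.length + 1 + (3 + j) by omega, this, add_comm 3]
    simp only [List.getD_cons_succ]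
    rw [List.getD_append _ _ _ _ (by simp), List.getD_eq_getElem _ _ (by simp)]
    simp
  rest i := by
    have := cell_append pre (D.den :: D.n :: m :: (List.ofFn D.num ++ rest)) (D.n + i + 3)
    rw [show pre.length + 4 + D.n + i = pre.length + 1 + (D.n + i + 3) by omega, this]
    simp only [List.getD_cons_succ]
    rw [List.getD_append_right _ _ _ _ (by simp)]
    simp
  length := by simp; omega

theorem layout_encSeq (x : SeqInst) :
    Layout (encSeq x) 0 x.toQualities x.found.length (x.found.flatMap bits) :=
  layout_append [] _ _ _

theorem layout_encSim (x : SimInst) :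
    Layout (encSim x) 0 x.toQualities x.a (List.replicate x.a 0) :=
  layout_append [] _ _ _

theorem layout_pairWord_encSeq (x : SeqInst) (v : List ℕ) :
    Layout (pairWord (encSeq x) v) 1 x.toQualities x.found.length (x.found.flatMap bits ++ v) := by
  have := layout_append [(encSeq x).length] x.toQualities x.found.length (x.found.flatMap bits ++ v)
  rw [← List.append_assoc] at this
  exact this

theorem layout_pairWord_encSim (x : SimInst) (v : List ℕ) :
    Layout (pairWord (encSim x) v) 1 x.toQualities x.a (List.replicate x.a 0 ++ v) := by
  have := layout_append [(encSim x).length] x.toQualities x.a (List.replicate x.a 0 ++ v)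
  rw [← List.append_assoc] at this
  exact this

theorem layout_encGreedyInput (x : GreedyInput) :
    Layout (encGreedyInput x) 3 x.toQualities x.a (List.replicate x.a 0) :=
  layout_append [x.k, x.tauNum, x.tauDen] _ _ _

theorem length_flatMap_bits {n : ℕ} (l : List (Selection n)) : (l.flatMap bits).length = l.length * n := by
  simp [List.length_flatMap, bits_length]

theorem getD_bits {n : ℕ} (s : Selection n) (j : Fin n) : (bits s).getD j 0 = (s j).toNat := by
  rw [List.getD_eq_getElem _ _ (by simp [bits_length])]
  simp [bits]

theorem getD_flatMap_bits {n : ℕ} : ∀ (l : List (Selection n)) (i : ℕ) (hi : i < l.length) (j : Fin n),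
    (l.flatMap bits).getD (i * n + j) 0 = (l[i] j).toNat
  | s :: l, 0, _, j => by
    rw [List.flatMap_cons, List.getD_append _ _ _ _ (by simp [bits_length])]
    simpa using getD_bits s j
  | s :: l, i + 1, hi, j => by
    rw [List.flatMap_cons, List.getD_append_right _ _ _ _ (by rw [bits_length, Nat.succ_mul]; omega),
      bits_length, Nat.succ_mul, show i * n + n + j - n = i * n + (j : ℕ) by omega,
      getD_flatMap_bits l i (by simpa using hi) j]
    rfl

theorem length_encTuple {n a : ℕ} (s : Fin (a + 1) → Selection n) :
    (encTuple s).length = (a + 1) * n := by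
  rw [encTuple, length_flatMap_bits, List.length_ofFn]

theorem getD_encTuple {n a : ℕ} (s : Fin (a + 1) → Selection n) (i : Fin (a + 1)) (j : Fin n) :
    (encTuple s).getD (i * n + j) 0 = (s i j).toNat := by
  rw [encTuple, getD_flatMap_bits _ _ (by simp; omega)]
  simp

/-! ### Decoding of words -/

theorem exists_bits {n : ℕ} {v : List ℕ} (hv : v.length = n) (h : ∀ x ∈ v, x ≤ 1) :
    ∃ s : Selection n, bits s = v := by
  subst hv
  refine ⟨fun j => decide (v[j] = 1), ?_⟩
  refine List.ext_getElem (by simp [bits_length]) fun i h1 h2 => ?_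
  have := h v[i] (List.getElem_mem h2)
  simp only [bits, List.getElem_ofFn, Fin.getElem_fin]
  rcases Nat.le_one_iff_eq_zero_or_eq_one.1 this with h | h <;> simp [h]

theorem exists_flatMap_bits {n : ℕ} : ∀ (m : ℕ) {v : List ℕ}, v.length = m * n → (∀ x ∈ v, x ≤ 1) →
    ∃ l : List (Selection n), l.length = m ∧ l.flatMap bits = v
  | 0, v, hv, _ => ⟨[], rfl, by simpa [eq_comm] using hv⟩
  | m + 1, v, hv, h => by
    rw [Nat.succ_mul] at hv
    obtain ⟨s, hs⟩ := exists_bits (n := n) (v := v.take n) (by simp; omega)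
      fun x hx => h x (List.mem_of_mem_take hx)
    obtain ⟨l, hl, hl'⟩ := exists_flatMap_bits (n := n) m (v := v.drop n) (by simp; omega)
      fun x hx => h x (List.mem_of_mem_drop hx)
    exact ⟨s :: l, by simp [hl], by rw [List.flatMap_cons, hs, hl', List.take_append_drop]⟩

theorem exists_encTuple {n a : ℕ} {v : List ℕ} (hv : v.length = (a + 1) * n) (h : ∀ x ∈ v, x ≤ 1) :
    ∃ s : Fin (a + 1) → Selection n, encTuple s = v := by
  obtain ⟨l, hl, rfl⟩ := exists_flatMap_bits (a + 1) hv h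
  refine ⟨fun i => l[i], ?_⟩
  rw [encTuple]
  congr 1
  exact List.ext_getElem (by simp [hl]) fun i h1 h2 => by simp only [List.getElem_ofFn, Fin.getElem_fin]

theorem forall_mem_iff_getD {v : List ℕ} {m : ℕ} (hv : v.length = m) (P : ℕ → Prop) :
    (∀ x ∈ v, P x) ↔ ∀ i < m, P (v.getD i 0) := by
  subst hv
  simp only [List.forall_mem_iff_getElem]
  exact forall₂_congr fun i hi => by rw [List.getD_eq_getElem _ _ hi]

/-- Decomposition of a word into qualities, a number and further letters. -/
theorem exists_layout {w : List ℕ} (h : 3 + cell w 2 ≤ w.length) :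
    ∃ (D : Qualities) (m : ℕ) (rest : List ℕ),
      w = D.den :: D.n :: m :: (List.ofFn D.num ++ rest) := by
  rcases w with _ | ⟨d, _ | ⟨n, _ | ⟨m, t⟩⟩⟩
  · simp at h
  · simp at h; omega
  · simp at h; omega
  · simp only [cell, List.getD_cons_succ, List.getD_cons_zero, List.length_cons] at h
    refine ⟨⟨n, d, fun j => t[(j : ℕ)]'(by omega)⟩, m, t.drop n, ?_⟩
    have : (List.ofFn fun j : Fin n => t[(j : ℕ)]'(by omega)) = t.take n := by
      refine List.ext_getElem (by simp; omega) fun i h1 h2 => by simp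
    simp [this]

theorem exists_encSeq {w : List ℕ} (h : w.length = 3 + cell w 2 + cell w 3 * cell w 2)
    (h1 : ∀ i < cell w 3 * cell w 2, cell w (4 + cell w 2 + i) ≤ 1) : ∃ x, encSeq x = w := by
  obtain ⟨D, m, rest, rfl⟩ := exists_layout (w := w) (by omega)
  have hl := layout_append [] D m rest
  simp only [List.nil_append, List.length_nil] at hl
  have hm := hl.m
  have hn := hl.n
  have hr := hl.rest
  simp only [zero_add] at hm hn hr
  rw [hl.length, hm, hn] at h
  rw [hm, hn] at h1
  have hlen : rest.length = m * D.n := by omega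
  obtain ⟨l, hm', rfl⟩ := exists_flatMap_bits m hlen
    ((forall_mem_iff_getD hlen (· ≤ 1)).2 fun i hi => by rw [← hr]; exact h1 i hi)
  exact ⟨⟨D, l⟩, by simp [encSeq, hm']⟩

theorem exists_encSim {w : List ℕ} (h : w.length = 3 + cell w 2 + cell w 3)
    (h1 : ∀ i < cell w 3, cell w (4 + cell w 2 + i) = 0) : ∃ x, encSim x = w := by
  obtain ⟨D, m, rest, rfl⟩ := exists_layout (w := w) (by omega)
  have hl := layout_append [] D m rest
  simp only [List.nil_append, List.length_nil] at hl
  have hm := hl.m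
  have hn := hl.n
  have hr := hl.rest
  simp only [zero_add] at hm hn hr
  rw [hl.length, hm, hn] at h
  rw [hm, hn] at h1
  have hlen : rest.length = m := by omega
  have : rest = List.replicate m 0 := List.eq_replicate_iff.2 ⟨hlen,
    (forall_mem_iff_getD hlen (· = 0)).2 fun i hi => by rw [← hr]; exact h1 i hi⟩
  exact ⟨⟨D, m⟩, by simp [encSim, this]⟩

/-! ### Counting with decision vectors -/

theorem card_featureSet {n : ℕ} (s : Selection n) : (featureSet s).card = ∑ j, (s j).toNat := by
  rw [featureSet, Finset.card_filter]
  exact Finset.sum_congr rfl fun j _ => by cases s j <;> rfl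

theorem card_inter_featureSet {n : ℕ} (s s' : Selection n) :
    (featureSet s ∩ featureSet s').card = ∑ j, (s j).toNat * (s' j).toNat := by
  rw [featureSet, featureSet, ← Finset.filter_and, Finset.card_filter]
  exact Finset.sum_congr rfl fun j _ => by cases s j <;> cases s' j <;> rfl

/-- The quality of a decision vector, multiplied by the common denominator. -/
def Qualities.score (D : Qualities) (s : Selection D.n) : ℕ := ∑ j, D.num j * (s j).toNat

theorem univariateQuality_eq_score (D : Qualities) (s : Selection D.n) :
    univariateQuality D.q s = (D.score s : ℚ) / D.den := by
  rw [univariateQuality, Qualities.score, Nat.cast_sum, Finset.sum_div]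
  refine Finset.sum_congr rfl fun j _ => ?_
  cases h : s j <;> simp [Qualities.q]

/-! ### Terms for the parts of the input -/

/-- The common denominator. -/
def denT (o : ℕ) : Term := .inp (.lit (o + 1))

/-- The number of features. -/
def nT (o : ℕ) : Term := .inp (.lit (o + 2))

/-- The number of given feature sets or of alternatives. -/
def mT (o : ℕ) : Term := .inp (.lit (o + 3))

/-- The numerator of the quality of feature `j`. -/
def numT (o : ℕ) (j : Term) : Term := .inp (.bin .add (.lit (o + 4)) j)

/-- The `i`-th letter behind the qualities. -/
def restT (o : ℕ) (i : Term) : Term := .inp (.bin .add (.bin .add (.lit (o + 4)) (nT o)) i)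

/-- The index `i * n + j`. -/
def idxT (o : ℕ) (i j : Term) : Term := .bin .add (.bin .mul i (nT o)) j

namespace Layout

variable {w : List ℕ} {o : ℕ} {D : Qualities} {m : ℕ} {rest : List ℕ}

theorem eval_denT (hl : Layout w o D m rest) (ρ : ℕ → ℕ) : (denT o).eval w ρ = D.den := hl.den

theorem eval_nT (hl : Layout w o D m rest) (ρ : ℕ → ℕ) : (nT o).eval w ρ = D.n := hl.n

theorem eval_mT (hl : Layout w o D m rest) (ρ : ℕ → ℕ) : (mT o).eval w ρ = m := hl.m

theorem eval_numT (hl : Layout w o D m rest) (ρ : ℕ → ℕ) {t : Term} (j : Fin D.n)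
    (ht : t.eval w ρ = j) : (numT o t).eval w ρ = D.num j := by rw [← hl.num, ← ht]; rfl

theorem eval_restT (hl : Layout w o D m rest) (ρ : ℕ → ℕ) (t : Term) :
    (restT o t).eval w ρ = rest.getD (t.eval w ρ) 0 := by
  rw [← hl.rest, ← hl.n]; rfl

theorem eval_idxT (hl : Layout w o D m rest) (ρ : ℕ → ℕ) (i j : Term) :
    (idxT o i j).eval w ρ = i.eval w ρ * D.n + j.eval w ρ := by
  rw [← hl.n]; rfl

theorem n_le (hl : Layout w o D m rest) : D.n ≤ (w.length + 1) ^ 1 := by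
  have := hl.length; rw [pow_one]; omega

theorem eval_sum_n (hl : Layout w o D m rest) (ρ : ℕ → ℕ) (v : ℕ) (body : Term) :
    (Term.sumLT v 1 (nT o) body).eval w ρ =
      ∑ j : Fin D.n, body.eval w (Function.update ρ v j) := by
  rw [Term.eval_sumLT (fun _ => hl.eval_nT _) hl.n_le, Finset.sum_range]

theorem holds_ball_n (hl : Layout w o D m rest) (ρ : ℕ → ℕ) (v : ℕ) (body : Term) :
    (Term.ball v 1 (nT o) body).Holds w ρ ↔
      ∀ j < D.n, body.Holds w (Function.update ρ v j) :=
  Term.holds_ball (fun _ => hl.eval_nT _) hl.n_le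

theorem eval_score (hl : Layout w o D m rest) (ρ : ℕ → ℕ) {B : Term → Term} {s : Selection D.n}
    (hB : ∀ j : Fin D.n, (B (.var 2)).eval w (Function.update ρ 2 j) = (s j).toNat) :
    (Term.sumLT 2 1 (nT o) (.bin .mul (numT o (.var 2)) (B (.var 2)))).eval w ρ = D.score s := by
  rw [hl.eval_sum_n, Qualities.score]
  refine Finset.sum_congr rfl fun j _ => ?_
  rw [Term.eval_mul, hB, hl.eval_numT _ j (by simp)]

end Layout

end AFS

namespace AFS

open RAM

/-! ### Sequential search is in NPO -/

/-- The word `w` contains, after `o` letters, an instance of sequential search, and then `v`. -/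
abbrev SeqLayout (w : List ℕ) (o : ℕ) (x : SeqInst) (v : List ℕ) : Prop :=
  Layout w o x.toQualities x.found.length (x.found.flatMap bits ++ v)

theorem seqLayout_encSeq (x : SeqInst) : SeqLayout (encSeq x) 0 x [] := by
  simpa [SeqLayout] using layout_encSeq x

theorem seqLayout_pairWord (x : SeqInst) (v : List ℕ) : SeqLayout (pairWord (encSeq x) v) 1 x v :=
  layout_pairWord_encSeq x v

namespace SeqLayout

variable {w : List ℕ} {o : ℕ} {x : SeqInst} {v : List ℕ}

/-- Without features, found sets would occupy no letters and their number would not be bounded by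
the length of the word. Admissible instances have `n ≥ k ≥ 1`. -/
theorem m_le (hl : SeqLayout w o x v) (hn : 1 ≤ x.n) : x.found.length ≤ (w.length + 1) ^ 1 := by
  have := hl.length
  rw [List.length_append, length_flatMap_bits] at this
  have := Nat.le_mul_of_pos_right x.found.length hn
  rw [pow_one]; omega

theorem eval_found (hl : SeqLayout w o x v) (ρ : ℕ → ℕ) {i j : Term} {l : ℕ}
    (h : l < x.found.length) (hi : i.eval w ρ = l) (t : Fin x.n) (hj : j.eval w ρ = t) :
    (restT o (idxT o i j)).eval w ρ = (x.found[l] t).toNat := by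
  rw [hl.eval_restT, hl.eval_idxT, hi, hj, List.getD_append, getD_flatMap_bits _ _ h]
  rw [length_flatMap_bits]
  have : (l + 1) * x.n ≤ x.found.length * x.n := Nat.mul_le_mul_right _ h
  rw [Nat.succ_mul] at this
  have := t.2
  omega

theorem eval_extra (hl : SeqLayout w o x v) (ρ : ℕ → ℕ) (j : Term) :
    (restT o (idxT o (mT o) j)).eval w ρ = v.getD (j.eval w ρ) 0 := by
  rw [hl.eval_restT, hl.eval_idxT, hl.eval_mT, List.getD_append_right _ _ _ _
    (by rw [length_flatMap_bits]; omega), length_flatMap_bits, Nat.add_sub_cancel_left]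

end SeqLayout

/-- The decision vector with the bits `B j` has `k` features, of which each of the given feature
sets contains at most `p`. -/
def feasT (o k p : ℕ) (B : Term → Term) : Term :=
  .and (.eq (.sumLT 2 1 (nT o) (B (.var 2))) (.lit k))
    (.ball 2 1 (mT o) (.le (.sumLT 3 1 (nT o)
      (.bin .mul (restT o (idxT o (.var 2) (.var 3))) (B (.var 3)))) (.lit p)))

/-- The source `B` of the bits is left open: verification reads them from the word, exhaustive
search decodes them from a number. It is evaluated under two nestings of variables, hence two
hypotheses. -/
theorem holds_feasT {k : ℕ} {τ : ℝ} (hk : 1 ≤ k) (h1 : τ ≤ 1) {w : List ℕ} {o : ℕ} {x : SeqInst}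
    {v : List ℕ} (hl : SeqLayout w o x v) (hx : (sequentialProblem k τ).IsInst x) (ρ : ℕ → ℕ)
    {B : Term → Term} {s : Selection x.n}
    (hB : ∀ j : Fin x.n, (B (.var 2)).eval w (Function.update ρ 2 j) = (s j).toNat)
    (hB' : ∀ i, ∀ j : Fin x.n, (B (.var 3)).eval w
      (Function.update (Function.update ρ 2 i) 3 j) = (s j).toNat) :
    (feasT o k ⌊(1 - τ) * k⌋₊ B).Holds w ρ ↔ (sequentialProblem k τ).Feasible x s := by
  obtain ⟨-, hcard, hle⟩ := hx
  have hL := hl.m_le (by omega)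
  rw [feasT, Term.holds_and, Term.holds_eq, Term.holds_ball (fun _ => hl.eval_mT _) hL,
    hl.eval_sum_n]
  simp only [hB, ← card_featureSet, Term.eval_lit]
  change _ ↔ (featureSet s).card = k ∧ _
  refine and_congr_right fun hs => ?_
  rw [List.forall_mem_iff_getElem]
  refine forall₂_congr fun l h => ?_
  rw [isAlternative_iff hk h1 hs (hcard _ (List.getElem_mem h)), Term.holds_le, hl.eval_sum_n,
    Term.eval_lit, Finset.inter_comm, card_inter_featureSet]
  simp only [Term.eval_mul, hB']
  rw [Finset.sum_congr rfl fun j _ => ?_]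
  rw [hl.eval_found _ h (by simp) j (by simp)]

theorem bits_le_one {n : ℕ} (s : Selection n) : ∀ x ∈ bits s, x ≤ 1 := by
  intro x hx
  obtain ⟨j, rfl⟩ := (List.mem_ofFn' _ _).1 hx
  exact Bool.toNat_le (s j)

theorem flatMap_bits_le_one {n : ℕ} (l : List (Selection n)) : ∀ x ∈ l.flatMap bits, x ≤ 1 := by
  intro x hx
  obtain ⟨s, -, hs⟩ := List.mem_flatMap.1 hx
  exact bits_le_one s x hs

theorem wordSize_flatMap_bits_le {n : ℕ} (l : List (Selection n)) :
    wordSize (l.flatMap bits) ≤ l.length * n * 2 := by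
  rw [← length_flatMap_bits]
  refine wordSize_le _ 1 fun x hx => ?_
  exact (Nat.size_le_size (flatMap_bits_le_one l x hx)).trans_eq Nat.size_one

/-- The input encodes qualities of at least one feature and a list of feature sets. -/
def seqShapeT : Term :=
  .and (.eq (.inp (.lit 0)) (.bin .add (.bin .add (.lit 3) (nT 0)) (.bin .mul (mT 0) (nT 0))))
    (.and (.le (.lit 1) (nT 0))
      (.ball 0 1 (.bin .mul (mT 0) (nT 0)) (.le (restT 0 (.var 0)) (.lit 1))))

theorem cell_zero (w : List ℕ) : cell w 0 = w.length := rfl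

theorem holds_seqShapeT (w : List ℕ) :
    seqShapeT.Holds w 0 ↔ ∃ x : SeqInst, 1 ≤ x.n ∧ encSeq x = w := by
  rw [seqShapeT, Term.holds_and, Term.holds_and, Term.holds_eq, Term.holds_le]
  constructor
  · rintro ⟨h1, h2, h3⟩
    have h1 : w.length = 3 + cell w 2 + cell w 3 * cell w 2 := h1
    rw [Term.holds_ball (B := cell w 3 * cell w 2) (fun _ => rfl) (by rw [pow_one]; omega)] at h3
    obtain ⟨x, rfl⟩ := exists_encSeq h1 fun i hi => by
      have := h3 i hi
      rw [Term.holds_le] at this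
      simpa [restT, nT] using this
    exact ⟨x, by rwa [(layout_encSeq x).eval_nT] at h2, rfl⟩
  · rintro ⟨x, hn, rfl⟩
    have hl := layout_encSeq x
    have hlen := hl.length
    rw [length_flatMap_bits] at hlen
    simp only [Term.eval_inp, Term.eval_lit, Term.eval_add, Term.eval_mul, hl.eval_nT, hl.eval_mT,
      cell_zero]
    refine ⟨by omega, hn, ?_⟩
    rw [Term.holds_ball (B := x.found.length * x.n)
      (fun i => by rw [Term.eval_mul, hl.eval_nT, hl.eval_mT]) (by rw [pow_one]; omega)]
    intro i hi
    rw [Term.holds_le, hl.eval_restT]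
    exact (forall_mem_iff_getD (length_flatMap_bits _) (· ≤ 1)).1 (flatMap_bits_le_one _) i hi

/-- The encoded instance of sequential search is admissible. -/
def seqInstT (k c : ℕ) : Term :=
  .and (.le (.lit 1) (denT 0))
    (.and (.ball 0 1 (mT 0) (.eq (.sumLT 1 1 (nT 0) (restT 0 (idxT 0 (.var 0) (.var 1)))) (.lit k)))
      (.le (.bin .add (.lit k) (.bin .mul (mT 0) (.lit c))) (nT 0)))

theorem holds_seqInstT (k : ℕ) (τ : ℝ) {x : SeqInst} (hn : 1 ≤ x.n) :
    (seqInstT k ⌈τ * k⌉₊).Holds (encSeq x) 0 ↔ (sequentialProblem k τ).IsInst x := by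
  have hl := seqLayout_encSeq x
  rw [seqInstT, Term.holds_and, Term.holds_and, Term.holds_le, Term.holds_le,
    Term.holds_ball (fun _ => hl.eval_mT _) (hl.m_le hn)]
  simp only [Term.eval_lit, Term.eval_add, Term.eval_mul, hl.eval_nT, hl.eval_mT, hl.eval_denT]
  change _ ↔ 0 < x.den ∧ (∀ s ∈ x.found, (featureSet s).card = k) ∧
    k + x.found.length * ⌈τ * k⌉₊ ≤ x.n
  rw [List.forall_mem_iff_getElem]
  refine and_congr Iff.rfl (and_congr (forall₂_congr fun l h => ?_) Iff.rfl)
  rw [Term.holds_eq, hl.eval_sum_n, Term.eval_lit, card_featureSet]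
  rw [Finset.sum_congr rfl fun j _ => ?_]
  rw [hl.eval_found _ h (by simp) j (by simp)]

theorem sequentialProblem_inNPO {k : ℕ} {τ : ℝ} (hk : 1 ≤ k) (h1 : τ ≤ 1) :
    (sequentialProblem k τ).InNPO where
  recognize := by
    refine polyTime_answer (.and seqShapeT (seqInstT k ⌈τ * k⌉₊)) fun w _ => ?_
    rw [Term.holds_and, holds_seqShapeT]
    constructor
    · rintro ⟨⟨x, hn, rfl⟩, h⟩
      exact ⟨x, (holds_seqInstT k τ hn).1 h, rfl⟩
    · rintro ⟨x, hx, rfl⟩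
      have hn : 1 ≤ x.n := by have := hx.2.2; omega
      exact ⟨⟨x, hn, rfl⟩, (holds_seqInstT k τ hn).2 hx⟩
  bounded := by
    refine ⟨2 * Polynomial.X, fun (x : SeqInst) hx (y : Selection x.n) hy => ?_⟩
    have h2 := wordSize_flatMap_bits_le [y]
    have h3 := length_le_wordSize (encSeq x)
    have h4 := (layout_encSeq x).length
    simp only [List.flatMap_cons, List.flatMap_nil, List.append_nil, List.length_singleton] at h2
    change wordSize (bits y) ≤ (2 * Polynomial.X : Polynomial ℕ).eval (wordSize (encSeq x))
    simp only [Polynomial.eval_mul, Polynomial.eval_ofNat, Polynomial.eval_X]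
    omega
  verify := by
    -- The candidate is treated as one more row after the found sets. The `4` counts the leading
    -- letter of the pair and the three header letters.
    refine polyTime_answer (.and (.eq (.inp (.lit 0)) (.bin .add (.bin .add (.lit 4) (nT 1))
        (.bin .mul (.bin .add (mT 1) (.lit 1)) (nT 1))))
      (.and (.ball 0 1 (nT 1) (.le (restT 1 (idxT 1 (mT 1) (.var 0))) (.lit 1)))
        (feasT 1 k ⌊(1 - τ) * k⌋₊ fun j => restT 1 (idxT 1 (mT 1) j)))) ?_
    rintro ⟨x, v⟩ hx
    change Term.Holds (pairWord (encSeq x) v) 0 _ ↔ ∃ y : Selection x.n,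
      (sequentialProblem k τ).Feasible x y ∧ bits y = v
    have hl := seqLayout_pairWord x v
    have hlen := hl.length
    rw [List.length_append, length_flatMap_bits] at hlen
    have hfeas : ∀ y : Selection x.n, bits y = v →
        ((feasT 1 k ⌊(1 - τ) * k⌋₊ fun j => restT 1 (idxT 1 (mT 1) j)).Holds
          (pairWord (encSeq x) v) 0 ↔ (sequentialProblem k τ).Feasible x y) := by
      intro y hy
      refine holds_feasT hk h1 hl hx 0 (fun j => ?_) fun i j => ?_ <;>
      · rw [hl.eval_extra, Term.eval_var, Function.update_self, ← hy, getD_bits]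
    rw [Term.holds_and, Term.holds_and, Term.holds_eq, hl.holds_ball_n]
    simp only [Term.eval_lit, Term.eval_add, Term.eval_mul, hl.eval_nT, hl.eval_mT, Term.eval_inp,
      cell_zero, Term.holds_le, hl.eval_extra, Term.eval_var, Function.update_self, Nat.succ_mul]
    constructor
    · rintro ⟨h2, h3, h4⟩
      have hv : v.length = x.n := by omega
      obtain ⟨y, hy⟩ := exists_bits hv ((forall_mem_iff_getD hv (· ≤ 1)).2 h3)
      exact ⟨y, (hfeas y hy).1 h4, hy⟩
    · rintro ⟨y, hy, hyv⟩
      have hv : v.length = x.n := by rw [← hyv, bits_length]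
      refine ⟨by omega, ?_, (hfeas y hyv).2 hy⟩
      exact (forall_mem_iff_getD hv (· ≤ 1)).1 (by rw [← hyv]; exact bits_le_one y)
  evaluate := by
    refine polyTime_fraction (.sumLT 2 1 (nT 1) (.bin .mul (numT 1 (.var 2))
      (restT 1 (idxT 1 (mT 1) (.var 2))))) (denT 1) (fun z => by simp [pairWord]) ?_ ?_
    · rintro ⟨(x : SeqInst), (y : Selection x.n)⟩ ⟨hx, -⟩ ρ
      change 0 < Term.eval (pairWord (encSeq x) (bits y)) _ ρ
      rw [(seqLayout_pairWord x (bits y)).eval_denT]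
      exact hx.1
    · rintro ⟨(x : SeqInst), (y : Selection x.n)⟩ - ρ ρ'
      have hl := seqLayout_pairWord x (bits y)
      have := hl.eval_score ρ (B := fun j => restT 1 (idxT 1 (mT 1) j)) (s := y)
        (fun j => by rw [hl.eval_extra, Term.eval_var, Function.update_self, getD_bits])
      change univariateQuality x.q y = ((Term.eval (pairWord (encSeq x) (bits y)) _ ρ : ℕ) : ℚ) /
        (Term.eval (pairWord (encSeq x) (bits y)) _ ρ' : ℕ)
      rw [this, hl.eval_denT, univariateQuality_eq_score]

end AFS

namespace AFS

open RAM

/-! ### Simultaneous search is in NPO -/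

/-- The first index at which a finite sequence is minimal. -/
theorem exists_first_min {α : Type*} [LinearOrder α] (f : ℕ → α) {M : ℕ} (hM : 0 < M) :
    ∃ i₀ < M, (∀ i < M, f i₀ ≤ f i) ∧
      ∀ i < M, (∀ i' < M, f i ≤ f i' ∧ (i ≤ i' ∨ f i < f i')) ↔ i = i₀ := by
  -- Minimizing `(f i, i)` lexicographically makes the minimizer unique.
  obtain ⟨i₀, h0, hmin⟩ := Finset.exists_min_image (Finset.range M) (fun i => toLex (f i, i))
    ⟨0, Finset.mem_range.2 hM⟩
  simp only [Finset.mem_range, Prod.Lex.toLex_le_toLex] at h0 hmin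
  refine ⟨i₀, h0, fun i hi => ?_, fun i hi => ⟨fun h => ?_, ?_⟩⟩
  · rcases hmin i hi with h | h
    exacts [h.le, h.1.le]
  · obtain ⟨h1, h2⟩ := h i₀ h0
    rcases hmin i hi with h | ⟨h, h'⟩
    · exact absurd h1 (not_le.2 h)
    · rcases h2 with h2 | h2
      · exact le_antisymm h2 h'
      · exact absurd h h2.ne'
  · rintro rfl i' hi'
    rcases hmin i' hi' with h | ⟨h, h'⟩
    · exact ⟨h.le, .inr h⟩
    · exact ⟨h.le, .inl h'⟩

/-- The word `w` contains, after `o` letters, an instance of simultaneous search, and then `v`. -/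
abbrev SimLayout (w : List ℕ) (o : ℕ) (x : SimInst) (v : List ℕ) : Prop :=
  Layout w o x.toQualities x.a (List.replicate x.a 0 ++ v)

/-- Bit `j` of the `i`-th decision vector behind the instance. -/
def rowT (o : ℕ) (i j : Term) : Term := restT o (.bin .add (mT o) (idxT o i j))

namespace SimLayout

variable {w : List ℕ} {o : ℕ} {x : SimInst} {v : List ℕ}

theorem m_lt (hl : SimLayout w o x v) : x.a + 1 ≤ (w.length + 1) ^ 1 := by
  have := hl.length
  rw [List.length_append, List.length_replicate] at this
  rw [pow_one]; omega

theorem eval_extra (hl : SimLayout w o x v) (ρ : ℕ → ℕ) (j : Term) :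
    (restT o (.bin .add (mT o) j)).eval w ρ = v.getD (j.eval w ρ) 0 := by
  rw [hl.eval_restT, Term.eval_add, hl.eval_mT, List.getD_append_right _ _ _ _
    (by rw [List.length_replicate]; omega), List.length_replicate, Nat.add_sub_cancel_left]

theorem eval_rowT {y : Fin (x.a + 1) → Selection x.n} (hl : SimLayout w o x (encTuple y))
    (ρ : ℕ → ℕ) {i j : Term} (r : Fin (x.a + 1)) (hi : i.eval w ρ = r) (t : Fin x.n)
    (hj : j.eval w ρ = t) : (rowT o i j).eval w ρ = (y r t).toNat := by
  rw [rowT, hl.eval_extra, hl.eval_idxT, hi, hj, getD_encTuple]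

end SimLayout

/-- The input encodes qualities and a number, padded in unary. -/
def simShapeT : Term :=
  .and (.eq (.inp (.lit 0)) (.bin .add (.bin .add (.lit 3) (nT 0)) (mT 0)))
    (.ball 0 1 (mT 0) (.eq (restT 0 (.var 0)) (.lit 0)))

theorem holds_simShapeT (w : List ℕ) : simShapeT.Holds w 0 ↔ ∃ x, encSim x = w := by
  rw [simShapeT, Term.holds_and, Term.holds_eq]
  constructor
  · rintro ⟨h1, h3⟩
    have h1 : w.length = 3 + cell w 2 + cell w 3 := h1
    rw [Term.holds_ball (B := cell w 3) (fun _ => rfl) (by rw [pow_one]; omega)] at h3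
    refine exists_encSim h1 fun i hi => ?_
    have := h3 i hi
    rw [Term.holds_eq] at this
    simpa [restT, nT] using this
  · rintro ⟨x, rfl⟩
    have hl := layout_encSim x
    have hlen := hl.length
    rw [List.length_replicate] at hlen
    rw [Term.holds_ball (fun _ => hl.eval_mT _) (by rw [pow_one]; omega)]
    simp only [Term.eval_inp, Term.eval_lit, Term.eval_add, hl.eval_nT, hl.eval_mT, cell_zero,
      Term.holds_eq, hl.eval_restT, Term.eval_var, Function.update_self]
    refine ⟨by omega, fun i hi => ?_⟩
    rw [List.getD_eq_getElem _ _ (by simpa using hi), List.getElem_replicate]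

/-- The encoded instance of simultaneous search is admissible. -/
def simInstT (k c : ℕ) : Term :=
  .and (.le (.lit 1) (denT 0)) (.le (.bin .add (.lit k) (.bin .mul (mT 0) (.lit c))) (nT 0))

/-- The decision vectors behind the instance have `k` features each and pairwise at most `p` common
features. -/
def simFeasT (k p : ℕ) : Term :=
  .and (.ball 0 1 (.bin .add (mT 1) (.lit 1))
      (.eq (.sumLT 2 1 (nT 1) (rowT 1 (.var 0) (.var 2))) (.lit k)))
    (.ball 0 1 (.bin .add (mT 1) (.lit 1)) (.ball 1 1 (.var 0)
      (.le (.sumLT 2 1 (nT 1) (.bin .mul (rowT 1 (.var 0) (.var 2)) (rowT 1 (.var 1) (.var 2))))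
        (.lit p))))

/-- Intersections are symmetric, so pairs with `i' < i` suffice; these can be scanned by two nested
bounded quantifiers. -/
theorem feasible_iff (agg : ∀ a : ℕ, (Fin (a + 1) → ℚ) → ℚ) {k : ℕ} {τ : ℝ} (hk : 1 ≤ k)
    (h1 : τ ≤ 1) {x : SimInst} {y : Fin (x.a + 1) → Selection x.n} :
    (simultaneousProblem agg k τ).Feasible x y ↔ (∀ i, (featureSet (y i)).card = k) ∧
      ∀ i i', i' < i → (featureSet (y i) ∩ featureSet (y i')).card ≤ ⌊(1 - τ) * k⌋₊ := by
  change _ ∧ _ ↔ _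
  refine and_congr_right fun hy => ?_
  have hiff := fun i i' => isAlternative_iff hk h1 (hy i) (hy i')
  constructor
  · intro h i i' hii
    exact (hiff i i').1 (h i i' hii.ne')
  · intro h i i' hii
    rw [hiff]
    rcases lt_or_gt_of_ne hii with hlt | hlt
    · rw [Finset.inter_comm]; exact h i' i hlt
    · exact h i i' hlt

theorem holds_simFeasT (agg : ∀ a : ℕ, (Fin (a + 1) → ℚ) → ℚ) {k : ℕ} {τ : ℝ} (hk : 1 ≤ k)
    (h1 : τ ≤ 1) {w : List ℕ} {x : SimInst} {y : Fin (x.a + 1) → Selection x.n}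
    (hl : SimLayout w 1 x (encTuple y)) :
    (simFeasT k ⌊(1 - τ) * k⌋₊).Holds w 0 ↔ (simultaneousProblem agg k τ).Feasible x y := by
  have ha : ∀ ρ, (Term.bin .add (mT 1) (.lit 1)).eval w ρ = x.a + 1 := fun ρ => by
    rw [Term.eval_add, hl.eval_mT, Term.eval_lit]
  have hm := hl.m_lt
  rw [feasible_iff agg hk h1, simFeasT, Term.holds_and, Term.holds_ball (fun _ => ha _) hm,
    Term.holds_ball (fun _ => ha _) hm]
  refine and_congr ?_ ?_
  · rw [Fin.forall_iff]
    refine forall₂_congr fun i hi => ?_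
    rw [Term.holds_eq, hl.eval_sum_n, Term.eval_lit, card_featureSet]
    rw [Finset.sum_congr rfl fun j _ => ?_]
    rw [hl.eval_rowT _ ⟨i, hi⟩ (by simp) j (by simp)]
  · rw [Fin.forall_iff]
    refine forall₂_congr fun i hi => ?_
    rw [Term.holds_ball (B := i) (fun _ => by simp) (by omega)]
    have hinter : ∀ i' (hi' : i' < x.a + 1), (Term.le (.sumLT 2 1 (nT 1) (.bin .mul
        (rowT 1 (.var 0) (.var 2)) (rowT 1 (.var 1) (.var 2)))) (.lit ⌊(1 - τ) * k⌋₊)).Holds w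
        (Function.update (Function.update 0 0 i) 1 i') ↔
        (featureSet (y ⟨i, hi⟩) ∩ featureSet (y ⟨i', hi'⟩)).card ≤ ⌊(1 - τ) * k⌋₊ := by
      intro i' hi'
      rw [Term.holds_le, hl.eval_sum_n, Term.eval_lit, card_inter_featureSet]
      rw [Finset.sum_congr rfl fun j _ => ?_]
      rw [Term.eval_mul, hl.eval_rowT _ ⟨i, hi⟩ (by simp) j (by simp),
        hl.eval_rowT _ ⟨i', hi'⟩ (by simp) j (by simp)]
    constructor
    · intro h i' hi'
      exact (hinter i' i'.2).1 (h i' hi')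
    · intro h i' hi'
      exact (hinter i' (by omega)).2 (h ⟨i', by omega⟩ hi')

theorem wordSize_encTuple_le {n a : ℕ} (y : Fin (a + 1) → Selection n) :
    wordSize (encTuple y) ≤ (a + 1) * n * 2 := by
  have := wordSize_flatMap_bits_le (List.ofFn y)
  rwa [List.length_ofFn] at this

theorem encTuple_le_one {n a : ℕ} (y : Fin (a + 1) → Selection n) : ∀ x ∈ encTuple y, x ≤ 1 :=
  flatMap_bits_le_one _

/-- The aggregation matters only for evaluating the objective; it enters through a term `num` for
the numerator over the common denominator. -/
theorem simultaneousProblem_inNPO {agg : ∀ a : ℕ, (Fin (a + 1) → ℚ) → ℚ} {k : ℕ} {τ : ℝ} (hk : 1 ≤ k)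
    (h1 : τ ≤ 1) (num : Term)
    (hnum : ∀ (x : SimInst) (y : Fin (x.a + 1) → Selection x.n) (w : List ℕ) (ρ : ℕ → ℕ),
      SimLayout w 1 x (encTuple y) →
        agg x.a (fun i => univariateQuality x.q (y i)) = (num.eval w ρ : ℚ) / x.den) :
    (simultaneousProblem agg k τ).InNPO where
  recognize := by
    refine polyTime_answer (.and simShapeT (simInstT k ⌈τ * k⌉₊)) fun w _ => ?_
    have hinst : ∀ x : SimInst, (simInstT k ⌈τ * k⌉₊).Holds (encSim x) 0 ↔
        (simultaneousProblem agg k τ).IsInst x := by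
      intro x
      have hl := layout_encSim x
      rw [simInstT, Term.holds_and, Term.holds_le, Term.holds_le]
      simp only [Term.eval_lit, Term.eval_add, Term.eval_mul, hl.eval_nT, hl.eval_mT, hl.eval_denT]
      exact Iff.rfl
    rw [Term.holds_and, holds_simShapeT]
    constructor
    · rintro ⟨⟨x, rfl⟩, h⟩
      exact ⟨x, (hinst x).1 h, rfl⟩
    · rintro ⟨x, hx, rfl⟩
      exact ⟨⟨x, rfl⟩, (hinst x).2 hx⟩
  bounded := by
    -- A solution has `(a + 1) * n` bits of size at most `2`; the unary padding bounds `a + 1` by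
    -- the input size.
    refine ⟨2 * Polynomial.X ^ 2,
      fun (x : SimInst) hx (y : Fin (x.a + 1) → Selection x.n) hy => ?_⟩
    have h2 := wordSize_encTuple_le y
    have h3 := length_le_wordSize (encSim x)
    have h4 := (layout_encSim x).length
    rw [List.length_replicate] at h4
    change wordSize (encTuple y) ≤ (2 * Polynomial.X ^ 2 : Polynomial ℕ).eval (wordSize (encSim x))
    simp only [Polynomial.eval_mul, Polynomial.eval_ofNat, Polynomial.eval_pow, Polynomial.eval_X]
    have h5 : (x.a + 1) * x.n ≤ wordSize (encSim x) * wordSize (encSim x) :=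
      Nat.mul_le_mul (by omega) (by omega)
    rw [sq]; omega
  verify := by
    refine polyTime_answer (.and (.eq (.inp (.lit 0)) (.bin .add (.bin .add (.bin .add (.lit 4) (nT 1))
        (mT 1)) (.bin .mul (.bin .add (mT 1) (.lit 1)) (nT 1))))
      (.and (.ball 0 2 (.bin .mul (.bin .add (mT 1) (.lit 1)) (nT 1))
          (.le (restT 1 (.bin .add (mT 1) (.var 0))) (.lit 1)))
        (simFeasT k ⌊(1 - τ) * k⌋₊))) ?_
    rintro ⟨x, v⟩ hx
    change Term.Holds (pairWord (encSim x) v) 0 _ ↔ ∃ y : Fin (x.a + 1) → Selection x.n,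
      (simultaneousProblem agg k τ).Feasible x y ∧ encTuple y = v
    have hl : SimLayout (pairWord (encSim x) v) 1 x v := layout_pairWord_encSim x v
    have hlen := hl.length
    rw [List.length_append, List.length_replicate] at hlen
    have hfeas : ∀ y : Fin (x.a + 1) → Selection x.n, encTuple y = v →
        ((simFeasT k ⌊(1 - τ) * k⌋₊).Holds (pairWord (encSim x) v) 0 ↔
          (simultaneousProblem agg k τ).Feasible x y) := by
      rintro y rfl
      exact holds_simFeasT agg hk h1 hl
    have hm := hl.m_lt
    have hn := hl.n_le
    rw [Term.holds_and, Term.holds_and, Term.holds_eq, Term.holds_ball (B := (x.a + 1) * x.n)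
      (fun _ => by simp only [Term.eval_mul, Term.eval_add, hl.eval_mT, hl.eval_nT, Term.eval_lit])
      (by rw [pow_one] at hm hn; rw [sq]; exact Nat.mul_le_mul hm hn)]
    simp only [Term.eval_lit, Term.eval_add, Term.eval_mul, hl.eval_nT, hl.eval_mT, Term.eval_inp,
      cell_zero, Term.holds_le, hl.eval_extra, Term.eval_var, Function.update_self]
    constructor
    · rintro ⟨h2, h3, h4⟩
      have hv : v.length = (x.a + 1) * x.n := by omega
      obtain ⟨y, hy⟩ := exists_encTuple hv ((forall_mem_iff_getD hv (· ≤ 1)).2 h3)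
      exact ⟨y, (hfeas y hy).1 h4, hy⟩
    · rintro ⟨y, hy, hyv⟩
      have hv : v.length = (x.a + 1) * x.n := by rw [← hyv, length_encTuple]
      refine ⟨by omega, ?_, (hfeas y hyv).2 hy⟩
      exact (forall_mem_iff_getD hv (· ≤ 1)).1 (by rw [← hyv]; exact encTuple_le_one y)
  evaluate := by
    refine polyTime_fraction num (denT 1) (fun z => by simp [pairWord]) ?_ ?_
    · rintro ⟨(x : SimInst), (y : Fin (x.a + 1) → Selection x.n)⟩ ⟨hx, -⟩ ρ
      change 0 < Term.eval (pairWord (encSim x) (encTuple y)) _ ρ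
      rw [(layout_pairWord_encSim x (encTuple y)).eval_denT]
      exact hx.1
    · rintro ⟨(x : SimInst), (y : Fin (x.a + 1) → Selection x.n)⟩ - ρ ρ'
      have hl := layout_pairWord_encSim x (encTuple y)
      change agg x.a (fun i => univariateQuality x.q (y i)) =
        ((Term.eval (pairWord (encSim x) (encTuple y)) num ρ : ℕ) : ℚ) /
        (Term.eval (pairWord (encSim x) (encTuple y)) _ ρ' : ℕ)
      rw [hl.eval_denT, hnum x y _ ρ hl]

/-- The score of the `i`-th decision vector behind the instance. -/
def rowScoreT (i : Term) : Term :=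
  .sumLT 2 1 (nT 1) (.bin .mul (numT 1 (.var 2)) (rowT 1 i (.var 2)))

theorem eval_rowScoreT {w : List ℕ} {x : SimInst} {y : Fin (x.a + 1) → Selection x.n}
    (hl : SimLayout w 1 x (encTuple y)) (ρ : ℕ → ℕ) {i : Term} {r : ℕ} (hr : r < x.a + 1)
    (hi : ∀ j, i.eval w (Function.update ρ 2 j) = r) :
    (rowScoreT i).eval w ρ = x.score (y ⟨r, hr⟩) :=
  hl.eval_score ρ (B := fun j => rowT 1 i j)
    fun j => hl.eval_rowT _ ⟨r, hr⟩ (hi j) j (by simp)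

theorem sum_inNPO {k : ℕ} {τ : ℝ} (hk : 1 ≤ k) (h1 : τ ≤ 1) :
    (simultaneousProblem sumAgg k τ).InNPO := by
  refine simultaneousProblem_inNPO hk h1
    (.sumLT 0 1 (.bin .add (mT 1) (.lit 1)) (rowScoreT (.var 0))) fun x y w ρ hl => ?_
  have ha : ∀ ρ, (Term.bin .add (mT 1) (.lit 1)).eval w ρ = x.a + 1 := fun ρ => by
    rw [Term.eval_add, hl.eval_mT, Term.eval_lit]
  rw [Term.eval_sumLT (fun _ => ha _) hl.m_lt, Finset.sum_range, sumAgg, Nat.cast_sum,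
    Finset.sum_div]
  refine Finset.sum_congr rfl fun i _ => ?_
  rw [univariateQuality_eq_score, eval_rowScoreT hl _ i.2 (by simp)]

/-- The minimum is written as a sum over rows in which only the first row of minimal score
contributes. -/
theorem min_inNPO {k : ℕ} {τ : ℝ} (hk : 1 ≤ k) (h1 : τ ≤ 1) :
    (simultaneousProblem minAgg k τ).InNPO := by
  refine simultaneousProblem_inNPO hk h1 (.sum 0 1 (.bin .mul (.truth
    (.and (.lt (.var 0) (.bin .add (mT 1) (.lit 1))) (.ball 1 1 (.bin .add (mT 1) (.lit 1))
      (.and (.le (rowScoreT (.var 0)) (rowScoreT (.var 1))) (.or (.le (.var 0) (.var 1))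
        (.lt (rowScoreT (.var 0)) (rowScoreT (.var 1))))))))
    (rowScoreT (.var 0)))) fun x y w ρ hl => ?_
  have ha : ∀ ρ, (Term.bin .add (mT 1) (.lit 1)).eval w ρ = x.a + 1 := fun ρ => by
    rw [Term.eval_add, hl.eval_mT, Term.eval_lit]
  have hm := hl.m_lt
  set f : ℕ → ℕ := fun r => if hr : r < x.a + 1 then x.score (y ⟨r, hr⟩) else 0 with hf
  have hscore : ∀ ρ i r, r < x.a + 1 → (∀ j, (Term.var i).eval w (Function.update ρ 2 j) = r) →
      (rowScoreT (.var i)).eval w ρ = f r := by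
    intro ρ i r hr hi
    rw [eval_rowScoreT hl ρ hr hi, hf]
    simp [hr]
  obtain ⟨i₀, hi₀, hmin, huniq⟩ := exists_first_min f (M := x.a + 1) (by omega)
  rw [Term.eval_sum_unique (i₀ := i₀) (by omega), hscore _ 0 i₀ hi₀ (by simp)]
  · rw [minAgg]
    refine le_antisymm ?_ ?_
    · refine (Finset.inf'_le _ (Finset.mem_univ ⟨i₀, hi₀⟩)).trans_eq ?_
      rw [univariateQuality_eq_score, hf]
      simp [hi₀]
    · refine Finset.le_inf' _ _ fun i _ => ?_
      rw [univariateQuality_eq_score]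
      have : f i₀ ≤ x.score (y i) := by
        have e : f i = x.score (y i) := dif_pos i.2
        exact e ▸ hmin i i.2
      gcongr
  · intro i hi
    rw [Term.holds_and, Term.holds_lt, ha, Term.eval_var, Function.update_self,
      Term.holds_ball (fun _ => ha _) hm]
    constructor
    · rintro ⟨hi', h⟩
      refine (huniq i hi').1 fun i' hi'' => ?_
      have := h i' hi''
      rw [Term.holds_and, Term.holds_or, Term.holds_le, Term.holds_le, Term.holds_lt,
        hscore _ 0 i hi' (by simp), hscore _ 1 i' hi'' (by simp)] at this
      simpa using this
    · rintro rfl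
      refine ⟨hi₀, fun i' hi'' => ?_⟩
      rw [Term.holds_and, Term.holds_or, Term.holds_le, Term.holds_le, Term.holds_lt,
        hscore _ 0 i hi₀ (by simp), hscore _ 1 i' hi'' (by simp)]
      simpa using (huniq i hi₀).2 rfl i' hi''

end AFS

namespace AFS

open RAM

/-! ### Approximation algorithms for simultaneous search -/

/-- The remainder. -/
def modT (a b : Term) : Term := .bin .sub a (.bin .mul (.bin .div a b) b)

theorem eval_modT (w : List ℕ) (ρ : ℕ → ℕ) (a b : Term) :
    (modT a b).eval w ρ = a.eval w ρ % b.eval w ρ := by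
  rw [modT, Term.eval_sub, Term.eval_mul, Term.eval_div, Nat.mod_eq_sub_div_mul]

/-- The rank of feature `j`. -/
def rankT (o : ℕ) (j : Term) : Term :=
  .sumLT 1 1 (nT o) (.truth (.or (.lt (numT o j) (numT o (.var 1)))
    (.and (.eq (numT o (.var 1)) (numT o j)) (.lt (.var 1) j))))

/-- Over a common positive denominator, comparing qualities means comparing numerators. -/
theorem Layout.eval_rankT {w : List ℕ} {o : ℕ} {D : Qualities} {m : ℕ} {rest : List ℕ}
    (hl : Layout w o D m rest) (hD : 0 < D.den) (ρ : ℕ → ℕ) {t : Term} (j : Fin D.n)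
    (ht : ∀ i, t.eval w (Function.update ρ 1 i) = j) : (rankT o t).eval w ρ = rank D.q j := by
  have hD' : (0 : ℚ) < D.den := by exact_mod_cast hD
  rw [rankT, hl.eval_sum_n, rank, Finset.card_filter]
  refine Finset.sum_congr rfl fun i _ => ?_
  rw [Term.eval_truth]
  classical refine if_congr ?_ rfl rfl
  rw [Term.holds_or, Term.holds_and, Term.holds_lt, Term.holds_lt, Term.holds_eq,
    hl.eval_numT _ j (ht i), hl.eval_numT _ i (by simp), ht]
  simp only [Precedes, Qualities.q, Term.eval_var, Function.update_self, Fin.val_fin_lt]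
  rw [div_lt_div_iff_of_pos_right hD', div_left_inj' hD'.ne']
  norm_cast

/-- Letter `l` belongs to row `l / n` and column `l % n`. -/
theorem map_range_eq_encTuple {n a : ℕ} (s : Fin (a + 1) → Selection n) (g : ℕ → ℕ)
    (h : ∀ (i : Fin (a + 1)) (j : Fin n), g (i * n + j) = (s i j).toNat) :
    (List.range ((a + 1) * n)).map g = encTuple s := by
  refine List.ext_getElem (by simp [length_encTuple]) fun l h1 h2 => ?_
  have hl : l < (a + 1) * n := by simpa using h1
  have hn : 0 < n := Nat.pos_of_ne_zero (by rintro rfl; simp at hl)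
  rw [List.getElem_map, List.getElem_range, ← List.getD_eq_getElem _ 0 h2]
  have := h ⟨l / n, Nat.div_lt_of_lt_mul (by rwa [mul_comm])⟩ ⟨l % n, Nat.mod_lt _ hn⟩
  have h' := getD_encTuple s ⟨l / n, Nat.div_lt_of_lt_mul (by rwa [mul_comm])⟩
    ⟨l % n, Nat.mod_lt _ hn⟩
  simp only [Nat.div_add_mod'] at this h'
  rw [this, h']

/-- Tuples of decision vectors that are given by sets of ranks can be computed in polynomial time if
membership in these sets is given by a term. -/
theorem polyTime_rankSelection {α : Type} {enc : α → List ℕ} {P : α → Prop} (inst : α → SimInst)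
    (o : ℕ) (S : α → ℕ → Finset ℕ) (B : Term → Term → Term)
    (hl : ∀ x, P x → ∃ v, SimLayout (enc x) o (inst x) v)
    (hD : ∀ x, P x → 0 < (inst x).den)
    (hB : ∀ x, P x → ∀ ρ i r,
      (B i r).Holds (enc x) ρ ↔ r.eval (enc x) ρ ∈ S x (i.eval (enc x) ρ)) :
    PolyTime enc P fun x w =>
      w = encTuple fun i : Fin ((inst x).a + 1) => rankSelection (inst x).q (S x i) := by
  have hlen : ∀ x, P x → (Term.bin .mul (.bin .add (mT o) (.lit 1)) (nT o)).eval (enc x) 0 =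
      ((inst x).a + 1) * (inst x).n := fun x hx => by
    obtain ⟨v, hv⟩ := hl x hx
    rw [Term.eval_mul, Term.eval_add, hv.eval_mT, hv.eval_nT, Term.eval_lit]
  refine polyTime_of_terms (.bin .mul (.bin .add (mT o) (.lit 1)) (nT o))
    (.truth (B (.bin .div (.var 0) (nT o)) (rankT o (modT (.var 0) (nT o))))) 2 (fun x hx => ?_)
    fun x hx => ?_
  · obtain ⟨v, hv⟩ := hl x hx
    have hm := hv.m_lt
    have hn := hv.n_le
    rw [pow_one] at hm hn
    rw [hlen x hx, sq]
    exact Nat.mul_le_mul hm hn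
  · obtain ⟨v, hv⟩ := hl x hx
    rw [hlen x hx]
    refine map_range_eq_encTuple _ _ fun i j => ?_
    have hn : 0 < (inst x).n := j.pos
    have hr := hv.eval_rankT (hD x hx) (Function.update 0 0 (i * (inst x).n + j))
      (t := modT (.var 0) (nT o)) j (fun l => by
        rw [eval_modT, hv.eval_nT]
        simp [Nat.mod_eq_of_lt j.2])
    have hi : (Term.bin .div (.var 0) (nT o)).eval (enc x)
        (Function.update 0 0 (i * (inst x).n + j)) = i := by
      rw [Term.eval_div, hv.eval_nT, Term.eval_var, Function.update_self, mul_comm,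
        Nat.mul_add_div hn, Nat.div_eq_of_lt j.2, add_zero]
    rw [Term.eval_truth, hB x hx, hr, hi]
    simp only [rankSelection]
    split <;> simp [*]

/-- Membership of `r` in the ranks of the `i`-th result of Greedy Replacement Search. -/
def blockT (p c i r : Term) : Term :=
  .or (.lt r p) (.and (.le (.bin .add p (.bin .mul i c)) r)
    (.lt r (.bin .add (.bin .add p (.bin .mul i c)) c)))

theorem holds_blockT {w : List ℕ} {ρ : ℕ → ℕ} {p c i r : Term} :
    (blockT p c i r).Holds w ρ ↔
      r.eval w ρ ∈ blockRanks (p.eval w ρ) (c.eval w ρ) (i.eval w ρ) := by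
  simp [blockT, blockRanks]

/-- This makes the prefix length computable from a threshold given as a fraction; the block length
is then obtained as `k - p`. -/
theorem floor_eq_div {k a b : ℕ} (hb : 0 < b) (hab : a ≤ b) :
    ⌊(1 - (a : ℝ) / b) * k⌋₊ = (b - a) * k / b := by
  have hb' : (b : ℝ) ≠ 0 := by exact_mod_cast hb.ne'
  rw [← Nat.floor_div_eq_div (K := ℝ)]
  congr 1
  rw [Nat.cast_mul, Nat.cast_sub hab]
  field_simp

theorem GreedyInput.τ_nonneg (x : GreedyInput) : 0 ≤ x.τ := by
  unfold GreedyInput.τ; positivity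

theorem GreedyInput.τ_le_one {x : GreedyInput} (hx : x.IsValid) : x.τ ≤ 1 := by
  obtain ⟨-, h1, h2, -, -⟩ := hx
  rw [GreedyInput.τ, div_le_one (by exact_mod_cast h1)]
  exact_mod_cast h2

theorem polyTime_greedyTuple :
    PolyTime encGreedyInput GreedyInput.IsValid
      (fun x w => w = encTuple (greedyTuple x.k x.τ x.toSimInst)) := by
  -- Cells `1`, `2`, `3` hold `k` and the numerator and denominator of `τ`.
  set p : Term := .bin .div (.bin .mul (.bin .sub (.inp (.lit 3)) (.inp (.lit 2))) (.inp (.lit 1)))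
    (.inp (.lit 3)) with hp
  have := polyTime_rankSelection (enc := encGreedyInput) (P := GreedyInput.IsValid)
    GreedyInput.toSimInst 3 (fun x => blockRanks ⌊(1 - x.τ) * x.k⌋₊ ⌈x.τ * x.k⌉₊)
    (blockT p (.bin .sub (.inp (.lit 1)) p))
    (fun x _ => ⟨[], by simpa [SimLayout] using layout_encGreedyInput x⟩) (fun x hx => hx.2.2.2.1)
    (fun x hx ρ i r => by
      have h1 : p.eval (encGreedyInput x) ρ = ⌊(1 - x.τ) * x.k⌋₊ :=
        (floor_eq_div hx.2.1 hx.2.2.1).symm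
      have h2 : (Term.bin .sub (.inp (.lit 1)) p).eval (encGreedyInput x) ρ = ⌈x.τ * x.k⌉₊ := by
        rw [Term.eval_sub, h1]
        have h3 := floor_add_ceil x.τ_nonneg (GreedyInput.τ_le_one hx) x.k
        have h4 : (Term.inp (.lit 1)).eval (encGreedyInput x) ρ = x.k := rfl
        omega
      rw [holds_blockT, h1, h2])
  obtain ⟨P, T, h⟩ := this
  refine ⟨P, T, fun x hx => ?_⟩
  obtain ⟨t, m, h1, h2, h3⟩ := h x hx
  refine ⟨t, m, h1, h2, h3.trans ?_⟩
  congr 1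
  funext i
  rw [greedyTuple_eq hx.2.2.2.2, greedySelection_eq]

/-- For fixed `k` and `τ` the floor and the ceiling are literals of the program, so `τ` may be any
real number here. -/
theorem polyTime_greedyTuple_of_fixed (agg : ∀ a : ℕ, (Fin (a + 1) → ℚ) → ℚ) (k : ℕ) (τ : ℝ) :
    PolyTime encSim (simultaneousProblem agg k τ).IsInst
      (fun x w => w = encTuple (greedyTuple k τ x)) := by
  obtain ⟨P, T, h⟩ := polyTime_rankSelection (enc := encSim)
    (P := (simultaneousProblem agg k τ).IsInst) (fun x => x) 0
    (fun x => blockRanks ⌊(1 - τ) * k⌋₊ ⌈τ * k⌉₊)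
    (blockT (.lit ⌊(1 - τ) * k⌋₊) (.lit ⌈τ * k⌉₊))
    (fun x _ => ⟨[], by simpa [SimLayout] using layout_encSim x⟩) (fun x hx => hx.1)
    (fun x hx ρ i r => holds_blockT)
  refine ⟨P, T, fun x hx => ?_⟩
  obtain ⟨t, m, h1, h2, h3⟩ := h x hx
  refine ⟨t, m, h1, h2, h3.trans ?_⟩
  congr 1
  funext i
  rw [greedyTuple_eq hx.2, greedySelection_eq]

theorem polyTime_strideTuple (agg : ∀ a : ℕ, (Fin (a + 1) → ℚ) → ℚ) (k : ℕ) (τ : ℝ) :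
    PolyTime encSim (simultaneousProblem agg k τ).IsInst
      (fun x w => w = encTuple (strideTuple k x)) := by
  refine polyTime_rankSelection (enc := encSim)
    (P := (simultaneousProblem agg k τ).IsInst) (fun x => x) 0
    (fun x => strideRanks k (x.a + 1))
    (fun i r => .and (.lt r (.bin .mul (.bin .add (mT 0) (.lit 1)) (.lit k)))
      (.eq (modT r (.bin .add (mT 0) (.lit 1))) i))
    (fun x _ => ⟨[], by simpa [SimLayout] using layout_encSim x⟩) (fun x hx => hx.1)
    (fun x hx ρ i r => ?_)
  have hl := layout_encSim x
  rw [Term.holds_and, Term.holds_lt, Term.holds_eq, eval_modT, Term.eval_mul, Term.eval_add,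
    hl.eval_mT, Term.eval_lit, Term.eval_lit, strideRanks, Finset.mem_filter, Finset.mem_range]

/-! ### Feasibility and approximation factors -/

theorem feasible_greedyTuple (agg : ∀ a : ℕ, (Fin (a + 1) → ℚ) → ℚ) {k : ℕ} {τ : ℝ} (hk : 1 ≤ k)
    (h0 : 0 ≤ τ) (h1 : τ ≤ 1) {x : SimInst} (hx : k + x.a * ⌈τ * k⌉₊ ≤ x.n) :
    (simultaneousProblem agg k τ).Feasible x (greedyTuple k τ x) := by
  have hle : ∀ i : Fin (x.a + 1), k + i * ⌈τ * k⌉₊ ≤ x.n := fun i =>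
    (Nat.add_le_add_left (Nat.mul_le_mul_right _ (Nat.lt_succ_iff.1 i.2)) k).trans hx
  constructor
  · intro i
    rw [greedyTuple_eq hx]
    exact card_greedySelection h0 h1 (hle i)
  · intro i i' hii
    rw [greedyTuple_eq hx, greedyTuple_eq hx]
    exact isAlternative_greedySelection hk h0 h1 (hle i) (hle i') fun h => hii (Fin.ext h)

theorem feasible_strideTuple (agg : ∀ a : ℕ, (Fin (a + 1) → ℚ) → ℚ) {k : ℕ} {τ : ℝ} (hk : 1 ≤ k)
    (h1 : τ ≤ 1) {x : SimInst} (hx : (x.a + 1) * k ≤ x.n) :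
    (simultaneousProblem agg k τ).Feasible x (strideTuple k x) := by
  rw [feasible_iff agg hk h1]
  exact ⟨card_strideTuple hx, fun i i' hii => by simp [strideTuple_inter k x hii.ne']⟩

theorem mul_sumAgg_le {r : ℚ} {a : ℕ} {u v : Fin (a + 1) → ℚ} (h : ∀ i, r * u i ≤ v i) :
    r * sumAgg a u ≤ sumAgg a v := by
  rw [sumAgg, Finset.mul_sum]
  exact Finset.sum_le_sum fun i _ => h i

theorem mul_minAgg_le {r : ℚ} (hr : 0 ≤ r) {a : ℕ} {u v : Fin (a + 1) → ℚ}
    (h : ∀ i, ∃ i', r * u i' ≤ v i) : r * minAgg a u ≤ minAgg a v := by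
  refine Finset.le_inf' _ _ fun i _ => ?_
  obtain ⟨i', hi'⟩ := h i
  exact (mul_le_mul_of_nonneg_left (Finset.inf'_le _ (Finset.mem_univ i')) hr).trans hi'

theorem ratio_nonneg (k : ℕ) (τ : ℝ) : 0 ≤ ratio k τ := by unfold ratio; positivity

theorem isApproxAlgorithm_greedyTuple {agg : ∀ a : ℕ, (Fin (a + 1) → ℚ) → ℚ} {k : ℕ} {τ : ℝ}
    (hk : 1 ≤ k) (h0 : 0 ≤ τ) (h1 : τ ≤ 1)
    (hagg : ∀ (a : ℕ) (u v : Fin (a + 1) → ℚ), (∀ i, ratio k τ * u i ≤ v i) →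
      ratio k τ * agg a u ≤ agg a v) :
    (simultaneousProblem agg k τ).IsApproxAlgorithm (greedyTuple k τ) (ratio k τ) := by
  refine ⟨polyTime_greedyTuple_of_fixed agg k τ, fun (x : SimInst) hx _ =>
    ⟨feasible_greedyTuple agg hk h0 h1 hx.2, fun y hy => hagg _ _ _ fun i => ?_⟩⟩
  rw [greedyTuple_eq hx.2]
  exact ratio_mul_le_greedySelection x.q_nonneg hk h0 h1 i (hy.1 i)

theorem isApproxAlgorithm_sum {k : ℕ} {τ : ℝ} (hk : 1 ≤ k) (h0 : 0 ≤ τ) (h1 : τ ≤ 1) :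
    (simultaneousProblem sumAgg k τ).IsApproxAlgorithm (greedyTuple k τ) (ratio k τ) :=
  isApproxAlgorithm_greedyTuple hk h0 h1 fun _ _ _ => mul_sumAgg_le

theorem isApproxAlgorithm_min {k : ℕ} {τ : ℝ} (hk : 1 ≤ k) (h0 : 0 ≤ τ) (h1 : τ ≤ 1) :
    (simultaneousProblem minAgg k τ).IsApproxAlgorithm (greedyTuple k τ) (ratio k τ) :=
  isApproxAlgorithm_greedyTuple hk h0 h1 fun _ _ _ h =>
    mul_minAgg_le (ratio_nonneg k τ) fun i => ⟨i, h i⟩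

/-- This covers the case in which the greedy factor is zero: alternatives are then disjoint sets,
and it remains to compare the stride tuple with disjoint tuples. -/
theorem isApproxAlgorithm_strideTuple {agg : ∀ a : ℕ, (Fin (a + 1) → ℚ) → ℚ} {k : ℕ} {τ : ℝ}
    (hk : 1 ≤ k) (h0 : 0 ≤ τ) (h1 : τ ≤ 1) (hp : ⌊(1 - τ) * k⌋₊ = 0) {r : ℚ}
    (hagg : ∀ (x : SimInst) (y : Fin (x.a + 1) → Selection x.n), (x.a + 1) * k ≤ x.n →
      (∀ i, (featureSet (y i)).card = k) →
      (∀ i i', i ≠ i' → featureSet (y i) ∩ featureSet (y i') = ∅) →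
      r * agg x.a (fun i => univariateQuality x.q (y i)) ≤
        agg x.a (fun i => univariateQuality x.q (strideTuple k x i))) :
    (simultaneousProblem agg k τ).IsApproxAlgorithm (strideTuple k) r := by
  refine ⟨polyTime_strideTuple agg k τ, fun (x : SimInst) hx _ => ?_⟩
  -- With blocks of length `k`, the condition on `n` leaves room for `a + 1` disjoint sets.
  have hc : ⌈τ * k⌉₊ = k := by have := floor_add_ceil h0 h1 k; omega
  have hx' : (x.a + 1) * k ≤ x.n := by
    have := hx.2
    rw [hc] at this
    rw [Nat.succ_mul]; omega
  refine ⟨feasible_strideTuple agg hk h1 hx', fun y hy => hagg x y hx' hy.1 fun i i' hii => ?_⟩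
  rw [← Finset.card_eq_zero, ← Nat.le_zero, ← hp,
    ← isAlternative_iff hk h1 (hy.1 i) (hy.1 i')]
  exact hy.2 i i' hii

theorem ratio_pos {k : ℕ} {τ : ℝ} (hk : 1 ≤ k) (hp : ⌊(1 - τ) * k⌋₊ ≠ 0) : 0 < ratio k τ :=
  div_pos (by exact_mod_cast Nat.pos_of_ne_zero hp) (by exact_mod_cast hk)

theorem sum_inAPX {k : ℕ} {τ : ℝ} (hk : 1 ≤ k) (h0 : 0 ≤ τ) (h1 : τ ≤ 1) :
    (simultaneousProblem sumAgg k τ).InAPX := by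
  refine ⟨sum_inNPO hk h1, ?_⟩
  by_cases hp : ⌊(1 - τ) * k⌋₊ = 0
  · refine ⟨strideTuple k, 1, one_pos, isApproxAlgorithm_strideTuple hk h0 h1 hp ?_⟩
    intro x y _ hy hdisj
    rw [one_mul]
    exact sum_le_sum_strideTuple hk hy hdisj
  · exact ⟨_, _, ratio_pos hk hp, isApproxAlgorithm_sum hk h0 h1⟩

theorem min_inAPX {k : ℕ} {τ : ℝ} (hk : 1 ≤ k) (h0 : 0 ≤ τ) (h1 : τ ≤ 1) :
    (simultaneousProblem minAgg k τ).InAPX := by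
  refine ⟨min_inNPO hk h1, ?_⟩
  by_cases hp : ⌊(1 - τ) * k⌋₊ = 0
  · have hk' : (0 : ℚ) < k := by exact_mod_cast hk
    refine ⟨strideTuple k, 1 / k, by positivity, isApproxAlgorithm_strideTuple hk h0 h1 hp ?_⟩
    intro x y hx hy hdisj
    refine mul_minAgg_le (by positivity) fun i => ?_
    obtain ⟨i', hi'⟩ := exists_le_mul_strideTuple hk hx hy hdisj i
    exact ⟨i', by rwa [one_div, inv_mul_le_iff₀ hk']⟩
  · exact ⟨_, _, ratio_pos hk hp, isApproxAlgorithm_min hk h0 h1⟩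

end AFS

namespace AFS

open RAM

/-! ### Exhaustive sequential search -/

/-- The feature set whose elements are among the first `k` digits of `c` in base `b`. -/
def digitSelection (n b k c : ℕ) : Selection n := fun j => decide (∃ t < k, c / b ^ t % b = j)

/-- The `k` elements of the set, in any order, are the digits of its code. A set has several codes,
and codes with repeated digits give smaller sets; neither disturbs the search. -/
theorem exists_digitSelection {n b k : ℕ} (hb : n ≤ b) {s : Selection n}
    (hs : (featureSet s).card = k) : ∃ c < b ^ k, digitSelection n b k c = s := by
  let e := (featureSet s).equivFinOfCardEq hs
  let d : Fin k → Fin b := fun t => Fin.castLE hb (e.symm t)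
  refine ⟨finFunctionFinEquiv d, (finFunctionFinEquiv d).2, ?_⟩
  have hdig : ∀ t : Fin k, (finFunctionFinEquiv d : ℕ) / b ^ (t : ℕ) % b = (e.symm t : Fin n) := by
    intro t
    have := congrArg Fin.val (congrFun (finFunctionFinEquiv.symm_apply_apply d) t)
    rwa [finFunctionFinEquiv_symm_apply_val] at this
  funext j
  rw [Bool.eq_iff_iff, digitSelection, decide_eq_true_iff, ← mem_featureSet]
  constructor
  · rintro ⟨t, ht, h⟩
    rw [hdig ⟨t, ht⟩] at h
    rw [← Fin.ext h]
    exact (e.symm ⟨t, ht⟩).2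
  · intro hj
    refine ⟨e ⟨j, hj⟩, (e ⟨j, hj⟩).2, ?_⟩
    rw [hdig, Equiv.symm_apply_apply]

/-- A power of the length of the input word plus one. -/
def powT : ℕ → Term
  | 0 => .lit 1
  | t + 1 => .bin .mul (powT t) (.bin .add (.inp (.lit 0)) (.lit 1))

theorem eval_powT (w : List ℕ) (ρ : ℕ → ℕ) (t : ℕ) : (powT t).eval w ρ = (w.length + 1) ^ t := by
  induction t with
  | zero => rfl
  | succ t ih => rw [powT, Term.eval_mul, ih, pow_succ]; rfl

/-- One of the first `k` digits of `c` is `j`. -/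
def digitT : ℕ → Term → Term → Term
  | 0, _, _ => .lit 0
  | k + 1, c, j => .or (digitT k c j)
      (.eq (modT (.bin .div c (powT k)) (.bin .add (.inp (.lit 0)) (.lit 1))) j)

theorem holds_digitT (w : List ℕ) (ρ : ℕ → ℕ) (k : ℕ) (c j : Term) : (digitT k c j).Holds w ρ ↔
    ∃ t < k, c.eval w ρ / (w.length + 1) ^ t % (w.length + 1) = j.eval w ρ := by
  induction k with
  | zero => simp [digitT, Term.Holds]
  | succ k ih =>
    rw [digitT, Term.holds_or, ih, Term.holds_eq, eval_modT, Term.eval_div, eval_powT]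
    change _ ∨ _ / _ % (w.length + 1) = _ ↔ _
    constructor
    · rintro (⟨t, ht, h⟩ | h)
      · exact ⟨t, by omega, h⟩
      · exact ⟨k, by omega, h⟩
    · rintro ⟨t, ht, h⟩
      rcases Nat.lt_succ_iff_lt_or_eq.1 ht with ht | rfl
      · exact .inl ⟨t, ht, h⟩
      · exact .inr h

/-- The bit of feature `j` in the decision vector with code `c`. -/
def chosenT (k : ℕ) (c j : Term) : Term := .truth (digitT k c j)

theorem eval_chosenT {w : List ℕ} {ρ : ℕ → ℕ} {n k a : ℕ} {c t : Term} (hc : c.eval w ρ = a)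
    (j : Fin n) (ht : t.eval w ρ = j) :
    (chosenT k c t).eval w ρ = (digitSelection n (w.length + 1) k a j).toNat := by
  rw [chosenT, Term.eval_truth, holds_digitT, hc, ht, digitSelection]
  split
  · next h => rw [decide_eq_true h]; rfl
  · next h => rw [decide_eq_false h]; rfl

open Classical in
/-- The objective of exhaustive search: positive for feasible solutions, and larger for better
ones. -/
noncomputable def searchValue (k : ℕ) (τ : ℝ) (x : SeqInst) (s : Selection x.n) : ℕ :=
  if (sequentialProblem k τ).Feasible x s then 1 + x.score s else 0

/-- The decision vectors that exhaustive search goes through. -/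
def searchSelection (k : ℕ) (x : SeqInst) (c : ℕ) : Selection x.n :=
  digitSelection x.n ((encSeq x).length + 1) k c

/-- The order dual turns the first minimum into the first maximum. The unique characterization is
what allows a term to pick out this code. -/
theorem exists_searchIndex (k : ℕ) (τ : ℝ) (x : SeqInst) :
    ∃ c₀ < ((encSeq x).length + 1) ^ k,
      (∀ c < ((encSeq x).length + 1) ^ k, searchValue k τ x (searchSelection k x c) ≤
        searchValue k τ x (searchSelection k x c₀)) ∧
      ∀ c < ((encSeq x).length + 1) ^ k, (∀ c' < ((encSeq x).length + 1) ^ k,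
        searchValue k τ x (searchSelection k x c') ≤ searchValue k τ x (searchSelection k x c) ∧
        (c ≤ c' ∨ searchValue k τ x (searchSelection k x c') <
          searchValue k τ x (searchSelection k x c))) ↔ c = c₀ :=
  exists_first_min (fun c => OrderDual.toDual (searchValue k τ x (searchSelection k x c)))
    (by positivity)

/-- The result of exhaustive search. -/
noncomputable def exhaustiveSearch (k : ℕ) (τ : ℝ) (x : SeqInst) : Selection x.n :=
  searchSelection k x (exists_searchIndex k τ x).choose

/-- The objective of exhaustive search for the decision vector with code `c`. -/
def searchValueT (k p : ℕ) (c : Term) : Term :=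
  .bin .mul (.truth (feasT 0 k p (chosenT k c))) (.bin .add (.lit 1)
    (.sumLT 2 1 (nT 0) (.bin .mul (numT 0 (.var 2)) (chosenT k c (.var 2)))))

theorem eval_searchValueT {k : ℕ} {τ : ℝ} (hk : 1 ≤ k) (h1 : τ ≤ 1) {x : SeqInst}
    (hx : (sequentialProblem k τ).IsInst x) (ρ : ℕ → ℕ) {t : Term} {c : ℕ}
    (ht : ∀ i, t.eval (encSeq x) (Function.update ρ 2 i) = c)
    (ht' : ∀ i j, t.eval (encSeq x) (Function.update (Function.update ρ 2 i) 3 j) = c) :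
    (searchValueT k ⌊(1 - τ) * k⌋₊ t).eval (encSeq x) ρ =
      searchValue k τ x (searchSelection k x c) := by
  have hl := seqLayout_encSeq x
  have h2 : ∀ j : Fin x.n, (chosenT k t (.var 2)).eval (encSeq x) (Function.update ρ 2 j) =
      (searchSelection k x c j).toNat := fun j => eval_chosenT (ht j) j (by simp)
  have h3 : ∀ i, ∀ j : Fin x.n, (chosenT k t (.var 3)).eval (encSeq x)
      (Function.update (Function.update ρ 2 i) 3 j) = (searchSelection k x c j).toNat :=
    fun i j => eval_chosenT (ht' i j) j (by simp)
  rw [searchValueT, Term.eval_mul, Term.eval_truth, holds_feasT hk h1 hl hx ρ h2 h3, Term.eval_add,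
    hl.eval_score ρ h2, Term.eval_lit, searchValue]
  split <;> simp

theorem polyTime_exhaustiveSearch {k : ℕ} {τ : ℝ} (hk : 1 ≤ k) (h1 : τ ≤ 1) :
    PolyTime encSeq (sequentialProblem k τ).IsInst (fun x w => w = bits (exhaustiveSearch k τ x)) := by
  set G := searchValueT k ⌊(1 - τ) * k⌋₊ with hG
  -- Codes are held in variables `4` and `1`: variable `0` is the output position, and `2` and `3`
  -- are used inside the search value.
  refine polyTime_of_terms (nT 0) (.sum 4 k (.bin .mul (.truth (.ball 1 k (powT k)
      (.and (.le (G (.var 1)) (G (.var 4))) (.or (.le (.var 4) (.var 1))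
        (.lt (G (.var 1)) (G (.var 4)))))))
    (chosenT k (.var 4) (.var 0)))) 1 (fun x _ => ?_) fun x hx => ?_
  · rw [(layout_encSeq x).eval_nT]
    exact (layout_encSeq x).n_le
  · have hl := layout_encSeq x
    obtain ⟨hc, -, huniq⟩ := (exists_searchIndex k τ x).choose_spec
    rw [hl.eval_nT]
    refine List.ext_getElem (by simp [bits_length]) fun j h2 h3 => ?_
    have hj : j < x.n := by simpa using h2
    rw [List.getElem_map, List.getElem_range, Term.eval_sum_unique hc]
    · rw [eval_chosenT (n := x.n) (a := (exists_searchIndex k τ x).choose) (by simp) ⟨j, hj⟩ (by simp)]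
      simp [bits, exhaustiveSearch, searchSelection]
    · intro c hc'
      rw [Term.holds_ball (fun _ => eval_powT _ _ k) le_rfl, ← huniq c hc']
      refine forall₂_congr fun c' _ => ?_
      rw [Term.holds_and, Term.holds_or, Term.holds_le, Term.holds_le, Term.holds_lt,
        eval_searchValueT hk h1 hx _ (c := c') (by simp) (by simp),
        eval_searchValueT hk h1 hx _ (c := c) (by simp) (by simp)]
      simp

theorem isApproxAlgorithm_exhaustiveSearch {k : ℕ} {τ : ℝ} (hk : 1 ≤ k) (h1 : τ ≤ 1) :
    (sequentialProblem k τ).IsApproxAlgorithm (exhaustiveSearch k τ) 1 := by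
  refine ⟨polyTime_exhaustiveSearch hk h1, fun (x : SeqInst) hx hex => ?_⟩
  obtain ⟨-, hmax, -⟩ := (exists_searchIndex k τ x).choose_spec
  -- The summand `1` puts even feasible sets of quality zero above the infeasible ones, whose value
  -- is `0`; hence the winner is feasible as soon as any solution exists.
  have hbest : ∀ s : Selection x.n, (sequentialProblem k τ).Feasible x s →
      1 + x.score s ≤ searchValue k τ x (exhaustiveSearch k τ x) := by
    intro s hs
    obtain ⟨c, hc, hcs⟩ := exists_digitSelection (b := (encSeq x).length + 1)
      (by have := (layout_encSeq x).length; omega) hs.1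
    have := hmax c hc
    rwa [searchSelection, hcs, searchValue, if_pos hs] at this
  have hfeas : (sequentialProblem k τ).Feasible x (exhaustiveSearch k τ x) := by
    obtain ⟨s, hs⟩ := hex
    have := hbest s hs
    by_contra h
    rw [searchValue, if_neg h] at this
    omega
  refine ⟨hfeas, fun (y : Selection x.n) hy => ?_⟩
  have := hbest y hy
  rw [searchValue, if_pos hfeas] at this
  change 1 * univariateQuality x.q y ≤ univariateQuality x.q (exhaustiveSearch k τ x)
  rw [one_mul, univariateQuality_eq_score, univariateQuality_eq_score]
  have h : x.score y ≤ x.score (exhaustiveSearch k τ x) := by omega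
  gcongr

theorem sequential_inAPX {k : ℕ} {τ : ℝ} (hk : 1 ≤ k) (h1 : τ ≤ 1) :
    (sequentialProblem k τ).InAPX :=
  ⟨sequentialProblem_inNPO hk h1, _, 1, one_pos, isApproxAlgorithm_exhaustiveSearch hk h1⟩

/-- Greedy Replacement Search as a sequential search. -/
theorem sequential_greedyTuple {k : ℕ} {τ : ℝ} (hk : 1 ≤ k) (h0 : 0 ≤ τ) (h1 : τ ≤ 1) {x : SimInst}
    (hD : 0 < x.den) (hx : k + x.a * ⌈τ * k⌉₊ ≤ x.n) (i : Fin (x.a + 1)) :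
    (sequentialProblem k τ).IsInst (greedyIteration k τ x i) ∧
      (sequentialProblem k τ).Feasible (greedyIteration k τ x i) (greedyTuple k τ x i) := by
  have hle : ∀ l ≤ x.a, k + l * ⌈τ * k⌉₊ ≤ x.n := fun l hl =>
    (Nat.add_le_add_left (Nat.mul_le_mul_right _ hl) k).trans hx
  have hfound : (greedyIteration k τ x i).found =
      (List.range i).map (greedySelection x.q k τ) := by
    change (greedyReplacement x.q k x.a τ).take i = _
    rw [greedyReplacement_eq _ hx, ← List.map_take, List.take_range,
      min_eq_left i.2.le]
  refine ⟨⟨hD, ?_, ?_⟩, ?_, ?_⟩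
  · rw [hfound]
    intro s hs
    obtain ⟨l, hl, rfl⟩ := List.mem_map.1 hs
    have := List.mem_range.1 hl
    exact card_greedySelection h0 h1 (hle l (by omega))
  · have hlen : (greedyIteration k τ x i).found.length = i :=
      (congrArg List.length hfound).trans ((List.length_map _).trans List.length_range)
    rw [hlen]
    exact hle i (by omega)
  · rw [greedyTuple_eq hx]
    exact card_greedySelection h0 h1 (hle i (by omega))
  · rw [hfound, greedyTuple_eq hx]
    intro s hs
    obtain ⟨l, hl, rfl⟩ := List.mem_map.1 hs
    have := List.mem_range.1 hl
    exact isAlternative_greedySelection hk h0 h1 (hle i (by omega)) (hle l (by omega)) (by omega)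

end AFS

theorem mainTheorem6 :
    -- Greedy Replacement Search runs in polynomial time, uniformly in all parameters
    RAM.PolyTime AFS.encGreedyInput AFS.GreedyInput.IsValid
      (fun x w => w = AFS.encTuple (AFS.greedyTuple x.k x.τ x.toSimInst)) ∧
    ∀ (k : ℕ) (τ : ℝ), 1 ≤ k → 0 ≤ τ → τ ≤ 1 →
      -- the three problems are in APX
      (AFS.sequentialProblem k τ).InAPX ∧
      (AFS.simultaneousProblem AFS.sumAgg k τ).InAPX ∧
      (AFS.simultaneousProblem AFS.minAgg k τ).InAPX ∧
      -- sequential search: guarantee of Greedy Replacement Search in each iteration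
      (∀ x : AFS.SimInst, 0 < x.den → k + x.a * ⌈τ * k⌉₊ ≤ x.n →
        (AFS.greedyReplacement x.q k x.a τ).length = x.a + 1 ∧
        ∀ i : Fin (x.a + 1),
          (AFS.sequentialProblem k τ).IsInst (AFS.greedyIteration k τ x i) ∧
          (AFS.sequentialProblem k τ).Feasible (AFS.greedyIteration k τ x i)
            (AFS.greedyTuple k τ x i) ∧
          ∀ (found : List (AFS.Selection x.n)) (s : AFS.Selection x.n),
            (AFS.sequentialProblem k τ).Feasible ⟨x.toQualities, found⟩ s →
            AFS.ratio k τ * AFS.univariateQuality x.q s ≤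
              AFS.univariateQuality x.q (AFS.greedyTuple k τ x i)) ∧
      -- simultaneous search: Greedy Replacement Search is an approximation algorithm
      (∀ x, (AFS.simultaneousProblem AFS.sumAgg k τ).IsInst x →
        (AFS.simultaneousProblem AFS.sumAgg k τ).Feasible x (AFS.greedyTuple k τ x)) ∧
      (∀ x, (AFS.simultaneousProblem AFS.minAgg k τ).IsInst x →
        (AFS.simultaneousProblem AFS.minAgg k τ).Feasible x (AFS.greedyTuple k τ x)) ∧
      (AFS.simultaneousProblem AFS.sumAgg k τ).IsApproxAlgorithm
        (AFS.greedyTuple k τ) (AFS.ratio k τ) ∧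
      (AFS.simultaneousProblem AFS.minAgg k τ).IsApproxAlgorithm
        (AFS.greedyTuple k τ) (AFS.ratio k τ) := by
  refine ⟨AFS.polyTime_greedyTuple, fun k τ hk h0 h1 => ⟨AFS.sequential_inAPX hk h1,
    AFS.sum_inAPX hk h0 h1, AFS.min_inAPX hk h0 h1, fun x hD hx => ⟨?_, fun i => ?_⟩,
    fun x hx => AFS.feasible_greedyTuple _ hk h0 h1 hx.2,
    fun x hx => AFS.feasible_greedyTuple _ hk h0 h1 hx.2,
    AFS.isApproxAlgorithm_sum hk h0 h1, AFS.isApproxAlgorithm_min hk h0 h1⟩⟩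
  · rw [AFS.greedyReplacement_eq _ hx, List.length_map, List.length_range]
  · obtain ⟨h2, h3⟩ := AFS.sequential_greedyTuple hk h0 h1 hD hx i
    refine ⟨h2, h3, fun found s hs => ?_⟩
    rw [AFS.greedyTuple_eq hx]
    exact AFS.ratio_mul_le_greedySelection x.q_nonneg hk h0 h1 i hs.1
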